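/- All graphs are finite, undirected and simple. **Definitions.** A graph $G$ contains a subdivision of a graph $H$ in which the vertex $f(v)$ of $G$ corresponds to the vertex $v$ of $H$ if $f:V(H)\to V(G)$ is injective and to every edge $xy$ of $H$ one can assign an $f(x)$–$f(y)$ path in $G$ such that no internal vertex of such a path lies in $f(V(H))$ and paths assigned to distinct edges have no internal vertex in common. The graph $P_n^3$ has vertices $v_1,\dots,v_n$, with $v_i$ adjacent to $v_j$ if and only if $1\le |i-j|\le 3$. Consider pairs $(G,K)$, where $K$ is a complete subgraph of $G$, possibly empty, with a total order $v_1<\dots<v_k$ of its vertices, and suppose $V(K)\ne V(G)$. (i) If a vertex $w\in V(G)\setminus V(K)$ is adjacent to all vertices of $K$, then $(G,K)$ may be replaced by $(G,K')$, where $K'$ is $K$ together with $w$ as its new smallest vertex. (ii) If every vertex in $V(G)\setminus V(K)$ has a non-neighbour in $K$, then $(G,K)$ may be replaced by $(G',K-v_1)$, where $G'$ is obtained from $G$ by deleting $v_1$ and joining each former neighbour $u\notin V(K)$ of $v_1$ to the vertex $v_j$ with the smallest index $j$ such that $uv_j\notin E(G)$. Write $(G,K)\to(G',K')$ if $(G',K')$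 is obtained from $(G,K)$ by a finite sequence of such operations. Distinct vertices $u_1,\dots,u_t\in V(G)\setminus V(K)$ are $(n_1,\dots,n_t)$-joined to $K$ in $G$ if there is a set of internally disjoint paths in $G$, each with one endpoint in $\{u_1,\dots,u_t\}$, the other in $V(K)$, and no internal vertex in either set, such that no two of the paths have the same pair of endpoints and exactly $n_i$ of them have the endpoint $u_i$, for each $i$. A configuration $\mathcal C$ is a set of graphs, all containing terminal vertices $a_1,\dots,a_t$, with positive integer weights $n_1,\dots,n_t$. It is unavoidable if, for all $G$ and $(G',K')$ with $(G,\emptyset)\to(G',K')$, whenever $(u_1,\dots,u_t)$ is $(n_1,\dots,n_t)$-joined to $K'$ in $G'$, the graph $G$ contains a subdivision of some $H\in\mathcal C$ in which $u_i$ corresponds to $a_i$ for $1\le i\le t$. Let the following configurations be given by the edge sets of their graphs. - $\mathcal C_5$ (vertices $a_1,a_2,b_1,\dots,b_4$; terminals $a_1,a_2$; weights $4,4$): (a) $\{a_1b_1,a_2b_1,a_1b_2,a_2b_2,b_1b_2,a_1b_3,a_2b_3,b_2b_3,a_1b_4,b_2b_4,b_3b_4\}$, (b) $\{a_1b_1,a_2b_1,a_1b_2,a_2b_2,b_1b_2,a_1b_3,b_1b_3,b_2b_3,b_1b_4,b_2b_4,b_3b_4\}$,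 (c) $\{a_1b_1,a_2b_1,a_1b_2,a_2b_2,b_1b_2,a_2b_3,b_1b_3,b_2b_3,a_2b_4,b_2b_4,b_3b_4\}$. - $\mathcal C_6$ (vertices $a_1,a_2,a_3,b_1,b_2,b_3$; terminals $a_1,a_2,a_3$; weights $3,3,3$): (a) $\{a_1b_1,a_2b_1,a_3b_1,a_1b_2,a_2b_2,b_1b_2,a_1b_3,b_1b_3,b_2b_3\}$, (b) $\{a_1b_1,a_2b_1,a_3b_1,a_1b_2,a_3b_2,b_1b_2,a_3b_3,b_1b_3,b_2b_3\}$, (c) $\{a_1b_1,a_2b_1,a_3b_1,a_2b_2,a_3b_2,b_1b_2,a_2b_3,b_1b_3,b_2b_3\}$. - $\mathcal C_7$ (vertices $a_1,a_2,a_3,b_1,b_2$; terminals $a_1,a_2,a_3$; weights $2,2,2$): $\{a_1b_1,a_2b_1,a_3b_1,a_1b_2,a_2b_2,b_1b_2\}$. - $\mathcal C_8$ (vertices $a_1,a_2,a_3,b_1,b_2$; terminals $a_1,a_2,a_3$; weights $3,3,2$): $\{a_1a_2,a_1b_1,a_2b_1,a_3b_1,a_1b_2,a_2b_2,b_1b_2\}$.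 - $\mathcal C_9$ (vertices $a_1,a_2,a_3,a_4,b_1$; terminals $a_1,a_2,a_3,a_4$; weights $1,1,2,2$): (a) $\{a_1b_1,a_2b_1,a_3b_1,a_4b_1\}$, (b) $\{a_1b_1,a_2b_1,a_3a_4,a_3b_1\}$. **Theorem.** Every graph (with at least one vertex) of minimum degree at least $5$ contains a subdivision of $P_6^3$. Moreover, each of the configurations $\mathcal C_5,\mathcal C_6,\mathcal C_7,\mathcal C_8,\mathcal C_9$ is unavoidable. -/

import Mathlib

universe u

namespace UnavoidableConfig

/-- The internal vertices of a path: its vertices other than the two endpoints. -/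
def interior {V : Type*} {G : SimpleGraph V} {x y : V} (p : G.Walk x y) : Set V :=
  {z | z ∈ p.support ∧ z ≠ x ∧ z ≠ y}

/-- `G` contains a subdivision of `H` in which the vertex `f a` of `G` corresponds to the vertex
`a` of `H`: every edge `ab` of `H` is assigned an `f a`--`f b` path of `G` (read backwards as an
`f b`--`f a` path), no internal vertex of such a path corresponds to a vertex of `H`, and paths
assigned to distinct edges have no internal vertex in common. -/
def IsSubdivisionAt {V W : Type*} (G : SimpleGraph V) (H : SimpleGraph W) (f : W → V) : Prop :=
  Function.Injective f ∧
  ∃ P : ∀ a b : W, H.Adj a b → G.Walk (f a) (f b),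
    (∀ a b (h : H.Adj a b), (P a b h).IsPath) ∧
    (∀ a b (h : H.Adj a b), P b a h.symm = (P a b h).reverse) ∧
    (∀ a b (h : H.Adj a b), Disjoint (interior (P a b h)) (Set.range f)) ∧
    (∀ a b (h : H.Adj a b) c d (h' : H.Adj c d), s(a, b) ≠ s(c, d) →
      Disjoint (interior (P a b h)) (interior (P c d h')))

/-- `G` contains a subdivision of `H`. -/
def ContainsSubdivision {V W : Type*} (G : SimpleGraph V) (H : SimpleGraph W) : Prop :=
  ∃ f : W → V, IsSubdivisionAt G H f

/-- The cube of the path on `n` vertices: `i` and `j` are adjacent iff `1 ≤ |j - i| ≤ 3`. -/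
def pathCube (n : ℕ) : SimpleGraph (Fin n) where
  Adj i j := 1 ≤ |(j : ℤ) - (i : ℤ)| ∧ |(j : ℤ) - (i : ℤ)| ≤ 3
  symm := ⟨fun i j h => by rwa [abs_sub_comm] at h⟩
  loopless := ⟨fun i h => by simp at h⟩

/-- A pair consisting of a graph with vertex set `verts`, contained in the ambient type `V`, and
an ordered clique in it, listed in increasing order. -/
structure CliquePair (V : Type u) where
  /-- the vertex set of the graph -/
  verts : Set V
  /-- the adjacency relation of the graph; elements of `V` outside `verts` are isolated -/
  graph : SimpleGraph V
  mem_verts : ∀ x y, graph.Adj x y → x ∈ verts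
  /-- the vertices of the ordered clique, in increasing order -/
  clique : List V
  nodup : clique.Nodup
  clique_verts : ∀ x ∈ clique, x ∈ verts
  clique_adj : ∀ x ∈ clique, ∀ y ∈ clique, x ≠ y → graph.Adj x y

/-- The pair consisting of the graph `G` and the empty ordered clique. -/
def CliquePair.start {V : Type u} (G : SimpleGraph V) : CliquePair V where
  verts := Set.univ
  graph := G
  mem_verts := fun _ _ _ => Set.mem_univ _
  clique := []
  nodup := List.nodup_nil
  clique_verts := fun _ _ => Set.mem_univ _
  clique_adj := fun _ h => absurd h List.not_mem_nil

/-- `v` is the first vertex in the list `L` that is not adjacent to `x` in `G`. -/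
def IsFirstNonNeighbor {V : Type*} (G : SimpleGraph V) (L : List V) (x v : V) : Prop :=
  ∃ A B : List V, L = A ++ v :: B ∧ (∀ y ∈ A, G.Adj x y) ∧ ¬ G.Adj x v

/-- `q` is obtained from `p` by adding the vertex `w` to the clique, as its new smallest vertex;
`w` is a vertex outside the clique adjacent to all vertices of the clique. -/
def AddsVertex {V : Type u} (p q : CliquePair V) (w : V) : Prop :=
  w ∈ p.verts ∧ w ∉ p.clique ∧ (∀ x ∈ p.clique, p.graph.Adj w x) ∧
  q.verts = p.verts ∧ q.graph = p.graph ∧ q.clique = w :: p.clique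

/-- `q` is obtained from `p` by deleting the smallest vertex `v` of the clique. This is possible if
some vertex lies outside the clique and each such vertex has a non-neighbour in the clique. Every
neighbour `x` of `v` outside the clique is made adjacent to the first vertex of the clique
to which it was not adjacent. -/
def DeletesVertex {V : Type u} (p q : CliquePair V) (v : V) : Prop :=
  (∃ x ∈ p.verts, x ∉ p.clique) ∧
  (∀ x ∈ p.verts, x ∉ p.clique → ∃ y ∈ p.clique, ¬ p.graph.Adj x y) ∧
  p.clique = v :: q.clique ∧
  q.verts = p.verts \ {v} ∧
  ∀ x y, q.graph.Adj x y ↔ x ≠ v ∧ y ≠ v ∧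
    (p.graph.Adj x y ∨
      (p.graph.Adj v x ∧ x ∉ p.clique ∧ IsFirstNonNeighbor p.graph p.clique x y) ∨
      (p.graph.Adj v y ∧ y ∉ p.clique ∧ IsFirstNonNeighbor p.graph p.clique y x))

/-- `q` can be derived from `p` by a finite sequence of additions and deletions of vertices. -/
def Derives {V : Type u} : CliquePair V → CliquePair V → Prop :=
  Relation.ReflTransGen fun p q => (∃ w, AddsVertex p q w) ∨ (∃ v, DeletesVertex p q v)

/-- `(u 0, …, u (t - 1))` is `(n 0, …, n (t - 1))`-joined to the clique of `p` in the graph of `p`.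
Since no two of the joining paths may have the same pair of endpoints, the paths are
indexed by these pairs: `T i` is the set of endpoints in the clique of the `n i` paths that
start at `u i`, and `P i k` is the path from `u i` to `k`. -/
def IsJoined {V : Type u} (p : CliquePair V) {t : ℕ} (u : Fin t → V) (n : Fin t → ℕ) : Prop :=
  Function.Injective u ∧ (∀ i, u i ∈ p.verts ∧ u i ∉ p.clique) ∧
  ∃ T : Fin t → Finset V, (∀ i, (T i).card = n i) ∧ (∀ i, ∀ k ∈ T i, k ∈ p.clique) ∧
  ∃ P : ∀ (i : Fin t) (k : V), k ∈ T i → p.graph.Walk (u i) k,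
    (∀ i k (h : k ∈ T i), (P i k h).IsPath) ∧
    (∀ i k (h : k ∈ T i), Disjoint (interior (P i k h)) (Set.range u ∪ {x | x ∈ p.clique})) ∧
    (∀ i k (h : k ∈ T i) j l (h' : l ∈ T j), (i, k) ≠ (j, l) →
      Disjoint (interior (P i k h)) (interior (P j l h')))

/-- A configuration with `t` terminal vertices: a set of graphs on the vertices
`inl 0, …, inl (t - 1)` (the terminals) and `inr 0, …, inr (s - 1)`, with a positive
weight for every terminal. -/
structure Config (t s : ℕ) where
  graphs : Set (SimpleGraph (Fin t ⊕ Fin s))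
  weight : Fin t → ℕ
  weight_pos : ∀ i, 0 < weight i

/-- A configuration is unavoidable if, for every finite graph `G` and every pair `q` derived from
`G` with the empty clique, whenever `u` is joined to the clique of `q` with the weights of the
configuration, `G` contains a subdivision of a graph of the configuration in which `u i`
corresponds to the `i`-th terminal. -/
def Config.Unavoidable {t s : ℕ} (C : Config t s) : Prop :=
  ∀ (V : Type u) [Finite V] (G : SimpleGraph V) (q : CliquePair V),
    Derives (CliquePair.start G) q →
    ∀ u : Fin t → V, IsJoined q u C.weight →
      ∃ H ∈ C.graphs, ∃ f : Fin t ⊕ Fin s → V,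
        IsSubdivisionAt G H f ∧ ∀ i, f (Sum.inl i) = u i

/-- The graph with the edge set `E`. -/
abbrev ofEdges {t s : ℕ} (E : Set (Sym2 (Fin t ⊕ Fin s))) : SimpleGraph (Fin t ⊕ Fin s) :=
  SimpleGraph.fromEdgeSet E

/-- The terminal `a_(i+1)`. -/
abbrev a {t s : ℕ} (i : Fin t) : Fin t ⊕ Fin s := Sum.inl i

/-- The non-terminal vertex `b_(j+1)`. -/
abbrev b {t s : ℕ} (j : Fin s) : Fin t ⊕ Fin s := Sum.inr j

/-- Two terminals of weight 4, vertices `b_1, …, b_4`, three graphs. -/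
def C5 : Config 2 4 where
  graphs := {
    ofEdges {s(a 0, b 0), s(a 1, b 0), s(a 0, b 1), s(a 1, b 1), s(b 0, b 1), s(a 0, b 2),
      s(a 1, b 2), s(b 1, b 2), s(a 0, b 3), s(b 1, b 3), s(b 2, b 3)},
    ofEdges {s(a 0, b 0), s(a 1, b 0), s(a 0, b 1), s(a 1, b 1), s(b 0, b 1), s(a 0, b 2),
      s(b 0, b 2), s(b 1, b 2), s(b 0, b 3), s(b 1, b 3), s(b 2, b 3)},
    ofEdges {s(a 0, b 0), s(a 1, b 0), s(a 0, b 1), s(a 1, b 1), s(b 0, b 1), s(a 1, b 2),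
      s(b 0, b 2), s(b 1, b 2), s(a 1, b 3), s(b 1, b 3), s(b 2, b 3)}}
  weight := ![4, 4]
  weight_pos := by decide

/-- Three terminals of weight 3, vertices `b_1, b_2, b_3`, three graphs. -/
def C6 : Config 3 3 where
  graphs := {
    ofEdges {s(a 0, b 0), s(a 1, b 0), s(a 2, b 0), s(a 0, b 1), s(a 1, b 1), s(b 0, b 1),
      s(a 0, b 2), s(b 0, b 2), s(b 1, b 2)},
    ofEdges {s(a 0, b 0), s(a 1, b 0), s(a 2, b 0), s(a 0, b 1), s(a 2, b 1), s(b 0, b 1),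
      s(a 2, b 2), s(b 0, b 2), s(b 1, b 2)},
    ofEdges {s(a 0, b 0), s(a 1, b 0), s(a 2, b 0), s(a 1, b 1), s(a 2, b 1), s(b 0, b 1),
      s(a 1, b 2), s(b 0, b 2), s(b 1, b 2)}}
  weight := ![3, 3, 3]
  weight_pos := by decide

/-- Three terminals of weight 2, vertices `b_1, b_2`, one graph. -/
def C7 : Config 3 2 where
  graphs := {
    ofEdges {s(a 0, b 0), s(a 1, b 0), s(a 2, b 0), s(a 0, b 1), s(a 1, b 1), s(b 0, b 1)}}
  weight := ![2, 2, 2]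
  weight_pos := by decide

/-- Three terminals of weights 3, 3, 2, vertices `b_1, b_2`, one graph. -/
def C8 : Config 3 2 where
  graphs := {
    ofEdges {s(a 0, a 1), s(a 0, b 0), s(a 1, b 0), s(a 2, b 0), s(a 0, b 1), s(a 1, b 1),
      s(b 0, b 1)}}
  weight := ![3, 3, 2]
  weight_pos := by decide

/-- Four terminals of weights 1, 1, 2, 2, a vertex `b_1`, two graphs. -/
def C9 : Config 4 1 where
  graphs := {
    ofEdges {s(a 0, b 0), s(a 1, b 0), s(a 2, b 0), s(a 3, b 0)},
    ofEdges {s(a 0, b 0), s(a 1, b 0), s(a 2, a 3), s(a 2, b 0)}}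
  weight := ![1, 1, 2, 2]
  weight_pos := by decide

end UnavoidableConfig

/-!
The argument reads a derivation backwards. Let `u` be a family of vertices outside the clique of a
derived pair, linked to the clique by internally disjoint paths (`Joined`). All edges outside the
clique are edges of the original graph `G`, since the operations create only edges with an end
in the clique (`Derives.adj`); hence all of a linking path but its last edge lies in `G`.

* If the last operation deleted the vertex `v`, the links survive with the same numbers
  (`Joined.of_deletes`): the new edges of the links that start at one terminal end at vertices
  `k₁ < k₂ < …`, and these links can be led to `v, k₁, k₂, …` by edges of the previous graph.
* If it added the vertex `w` and only one of the considered terminals is linked to `w`, this link is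
  extended through `w` to another vertex of the clique. A free vertex exists because the maximum
  number of required links is attained by at least two terminals.
* If it added `w` and at least two terminals are linked to `w`, then `w` becomes a new terminal,
  which is linked to the whole remaining clique (`Joined.branch`). A structure found for some of the
  terminals, including `w`, is completed by the paths between `w` and the old terminals.

So an induction over the derivation (`forced_of_branches`) reduces every configuration to
configurations forced by fewer links, or to itself at an earlier stage. The chain of configurations
is `forces_edge`, `forces_claw`, `forces_path`, `forces_claw_edge`, `forces_star`, `forces_claw_path`,
followed by `C9`, `C7`, `C8`, `C6`, `C5`.

For a graph of minimum degree at least 5 the operations are applied until a single vertex `u` lies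
outside the clique. Degrees of vertices outside the clique never drop, so `u` has five links. Read
backwards, they can be rerouted until they lead to all vertices of a clique with five elements. Then
`u` and the vertex of the clique that is removed next are adjacent up to subdivision and both
have four further links, so `C5` applies (`contains_pathCube_of_joined`).

A family of internally disjoint paths of `G` is described by the set of pairs of their ends
(`Linkage`). The set `Z` in these notions contains all vertices that the interiors of the paths have to avoid.
"Weight `n`" of a vertex in the descriptions below means that at least `n` links start there.
-/

namespace UnavoidableConfig

/-! ### Walks and linkages -/

variable {V : Type u}

/-- Some walk of `G` from `x` to `y` stays inside `A`. -/
def Conn (G : SimpleGraph V) (A : Set V) (x y : V) : Prop :=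
  ∃ p : G.Walk x y, ∀ z ∈ p.support, z ∈ A

namespace Conn

variable {G : SimpleGraph V} {A B : Set V} {x y z : V}

theorem refl (h : x ∈ A) : Conn G A x x := ⟨.nil, by simpa using h⟩

theorem mono (h : Conn G A x y) (hAB : A ⊆ B) : Conn G B x y :=
  let ⟨p, hp⟩ := h
  ⟨p, fun z hz => hAB (hp z hz)⟩

theorem symm (h : Conn G A x y) : Conn G A y x :=
  let ⟨p, hp⟩ := h
  ⟨p.reverse, fun z hz => hp z (by simpa using hz)⟩

theorem trans (h : Conn G A x y) (h' : Conn G A y z) : Conn G A x z := by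
  obtain ⟨p, hp⟩ := h
  obtain ⟨q, hq⟩ := h'
  refine ⟨p.append q, fun v hv => ?_⟩
  rcases (SimpleGraph.Walk.mem_support_append_iff _ _).1 hv with hv | hv
  exacts [hp v hv, hq v hv]

theorem of_adj (h : G.Adj x y) (hx : x ∈ A) (hy : y ∈ A) : Conn G A x y :=
  ⟨h.toWalk, by simp [hx, hy]⟩

theorem right_mem (h : Conn G A x y) : y ∈ A :=
  let ⟨p, hp⟩ := h
  hp y p.end_mem_support

end Conn

/-- The edges in `E` are realized by paths of `G`, with interiors that avoid `Z` and are
disjoint for distinct edges. The set `I e` contains the interior of the path for `e`. -/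
def Linkage (G : SimpleGraph V) (Z : Set V) (E : Set (Sym2 V)) : Prop :=
  ∃ I : Sym2 V → Set V,
    (∀ x y, s(x, y) ∈ E → Conn G (I s(x, y) ∪ {x, y}) x y) ∧
    (∀ e ∈ E, Disjoint (I e) Z) ∧
    ∀ e ∈ E, ∀ e' ∈ E, e ≠ e' → Disjoint (I e) (I e')

namespace Linkage

variable {G : SimpleGraph V} {Z Z' : Set V} {E E' : Set (Sym2 V)}

theorem mono (h : Linkage G Z E) (hZ : Z' ⊆ Z) (hE : E' ⊆ E) : Linkage G Z' E' := by
  obtain ⟨I, h1, h2, h3⟩ := h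
  exact ⟨I, fun x y hxy => h1 x y (hE hxy), fun e he => (h2 e (hE he)).mono_right hZ,
    fun e he e' he' => h3 e (hE he) e' (hE he')⟩

theorem empty (G : SimpleGraph V) (Z : Set V) : Linkage G Z ∅ :=
  ⟨fun _ => ∅, by simp, by simp, by simp⟩

/-- Suppressing the vertex `w`: the paths for `xw` and `wy` are joined to a path for `xy`. -/
theorem suppress {x y w : V} (h : Linkage G (insert w Z) E) (hw : w ∉ Z)
    (hx : s(w, x) ∈ E) (hy : s(w, y) ∈ E) (hE : E' ⊆ insert s(x, y) {e ∈ E | w ∉ e}) :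
    Linkage G Z E' := by
  classical
  suffices Linkage G Z (insert s(x, y) {e ∈ E | w ∉ e}) from this.mono subset_rfl hE
  obtain ⟨I, h1, h2, h3⟩ := h
  let J : Set V := insert w (I s(w, x) ∪ I s(w, y))
  have hJ : Disjoint J Z := by
    rw [Set.disjoint_insert_left, Set.disjoint_union_left]
    exact ⟨hw, (h2 _ hx).mono_right (Set.subset_insert _ _),
      (h2 _ hy).mono_right (Set.subset_insert _ _)⟩
  have hJE : ∀ e ∈ E, w ∉ e → Disjoint J (I e) := by
    intro e he hwe
    rw [Set.disjoint_insert_left, Set.disjoint_union_left]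
    refine ⟨fun h => Set.disjoint_left.1 (h2 e he) h (Set.mem_insert _ _), h3 _ hx _ he ?_,
      h3 _ hy _ he ?_⟩ <;> rintro rfl <;> simp at hwe
  have hconn : Conn G (J ∪ {x, y}) x y := by
    refine ((h1 _ _ hx).symm.mono ?_).trans ((h1 _ _ hy).mono ?_) <;>
    · intro z
      simp only [J, Set.mem_union, Set.mem_insert_iff, Set.mem_singleton_iff]
      tauto
  refine ⟨fun e => if e = s(x, y) then J else I e, fun a b hab => ?_, fun e he => ?_,
    fun e he e' he' hne => ?_⟩
  · by_cases hs : s(a, b) = s(x, y)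
    · simp only [if_pos hs]
      rcases Sym2.eq_iff.1 hs with ⟨rfl, rfl⟩ | ⟨rfl, rfl⟩
      · exact hconn
      · exact hconn.symm.mono (by rw [Set.pair_comm])
    · simpa [hs] using h1 a b (hab.resolve_left hs).1
  · by_cases hs : e = s(x, y)
    · simpa [hs] using hJ
    · simpa [hs] using (h2 e (he.resolve_left hs).1).mono_right (Set.subset_insert _ _)
  · by_cases hs : e = s(x, y)
    · have hs' : e' ≠ s(x, y) := fun h => hne (hs.trans h.symm)
      simpa [hs, hs'] using hJE e' (he'.resolve_left hs').1 (he'.resolve_left hs').2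
    by_cases hs' : e' = s(x, y)
    · simpa [hs, hs'] using (hJE e (he.resolve_left hs).1 (he.resolve_left hs).2).symm
    simpa [hs, hs'] using h3 e (he.resolve_left hs).1 e' (he'.resolve_left hs').1 hne

/-- A linkage for the images of the edges of `H` is a subdivision of `H`. The injection `g` into `ℕ`
orients the edges of `H`, so that both orientations of an edge get the same path. -/
theorem isSubdivisionAt {W : Type*} [Countable W] {H : SimpleGraph W} {f : W → V}
    (h : Linkage G Z E) (hf : Function.Injective f) (hZ : ∀ a, f a ∈ Z)
    (hE : ∀ a b, H.Adj a b → s(f a, f b) ∈ E) : IsSubdivisionAt G H f := by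
  classical
  obtain ⟨I, h1, h2, h3⟩ := h
  have key : ∀ a b, H.Adj a b →
      ∃ p : G.Walk (f a) (f b), p.IsPath ∧ interior p ⊆ I s(f a, f b) := by
    intro a b hab
    obtain ⟨p, hp⟩ := h1 _ _ (hE a b hab)
    refine ⟨p.bypass, p.bypass_isPath, fun z hz => ?_⟩
    have := hp z (p.support_bypass_subset_support hz.1)
    simpa [hz.2.1, hz.2.2] using this
  choose p hp hpI using key
  obtain ⟨g, hg⟩ := exists_injective_nat W
  have hrev : ∀ a b (h : H.Adj a b), interior (p a b h).reverse = interior (p a b h) := by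
    intro a b h
    ext z
    simp [interior, and_comm]
  let P : ∀ a b, H.Adj a b → G.Walk (f a) (f b) := fun a b h =>
    if g a < g b then p a b h else (p b a h.symm).reverse
  have hPI : ∀ a b (h : H.Adj a b), interior (P a b h) ⊆ I s(f a, f b) := by
    intro a b h
    by_cases hab : g a < g b
    · simpa [P, hab] using hpI a b h
    · simpa [P, hab, hrev, Sym2.eq_swap] using hpI b a h.symm
  refine ⟨hf, P, fun a b h => ?_, fun a b h => ?_, fun a b h => ?_, fun a b h c d h' hne => ?_⟩
  · by_cases hab : g a < g b
    · simpa [P, hab] using hp a b h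
    · simpa [P, hab] using hp b a h.symm
  · rcases lt_or_gt_of_ne (hg.ne h.ne) with hab | hab
    · simp [P, hab, hab.not_gt]
    · simp [P, hab, hab.not_gt]
  · refine ((h2 _ (hE a b h)).mono_left (hPI a b h)).mono_right ?_
    rintro _ ⟨c, rfl⟩
    exact hZ c
  · refine (h3 _ (hE a b h) _ (hE c d h') ?_).mono (hPI a b h) (hPI c d h')
    exact fun heq => hne (Sym2.map.injective hf (by simpa using heq))

end Linkage

/-! ### Links to the clique -/

/-- Every vertex `v` is linked to the vertices in `T v` of the clique of `q`. A link from `v` to `k`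
is a walk of `G` outside the clique, followed by an edge of `q.graph` to `k`. Apart from `v`
the walk lies in a set `I v k` that avoids `Z`, and these sets are disjoint for distinct
links. The set `Z` contains all vertices with `T v` nonempty. -/
def Joined (G : SimpleGraph V) (q : CliquePair V) (Z : Set V) (T : V → Finset V) : Prop :=
  (∀ z ∈ Z, z ∈ q.verts ∧ z ∉ q.clique) ∧
  (∀ v, ∀ k ∈ T v, v ∈ Z ∧ k ∈ q.clique) ∧
  ∃ I : V → V → Set V,
    (∀ v, ∀ k ∈ T v, (∀ z ∈ I v k, z ∈ q.verts ∧ z ∉ q.clique ∧ z ∉ Z) ∧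
      ∃ x, Conn G (insert v (I v k)) v x ∧ q.graph.Adj x k) ∧
    ∀ v, ∀ k ∈ T v, ∀ v', ∀ k' ∈ T v', (v, k) ≠ (v', k') → Disjoint (I v k) (I v' k')

/-- Outside the clique no new edges arise. -/
theorem Derives.adj {G : SimpleGraph V} {q : CliquePair V} (h : Derives (.start G) q) {x y : V}
    (hx : x ∉ q.clique) (hy : y ∉ q.clique) (hxy : q.graph.Adj x y) : G.Adj x y := by
  induction h with
  | refl => exact hxy
  | tail _ hs ih =>
    rcases hs with ⟨w, -, -, -, -, hg, hc⟩ | ⟨v, -, -, hc, -, hg⟩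
    · rw [hc, List.mem_cons, not_or] at hx hy
      exact ih hx.2 hy.2 (hg ▸ hxy)
    · obtain ⟨hxv, hyv, hxy⟩ := (hg x y).1 hxy
      have hx' : x ∉ _ := fun h => (List.mem_cons.1 (hc ▸ h)).elim hxv hx
      have hy' : y ∉ _ := fun h => (List.mem_cons.1 (hc ▸ h)).elim hyv hy
      rcases hxy with h | ⟨-, -, A, B, hAB, -⟩ | ⟨-, -, A, B, hAB, -⟩
      · exact ih hx' hy' h
      · exact absurd (by simp [hAB]) hy'
      · exact absurd (by simp [hAB]) hx'

namespace Joined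

variable {G : SimpleGraph V} {q₀ q : CliquePair V} {Z : Set V} {T : V → Finset V} {w : V}

theorem mem_of_card_pos {v : V} (h : Joined G q Z T) (hv : 1 ≤ (T v).card) : v ∈ Z := by
  obtain ⟨k, hk⟩ := Finset.card_pos.1 hv
  exact (h.2.1 v k hk).1

open scoped Classical in
/-- Undoing the addition of `w`, all links to `w` being forgotten. -/
theorem erase (h : Joined G q Z T) (hw : AddsVertex q₀ q w) :
    Joined G q₀ Z fun v => (T v).erase w := by
  obtain ⟨hZ, hT, I, hI, hd⟩ := h
  obtain ⟨hwv, hwc, hwa, hv, hg, hc⟩ := hw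
  have hcl : ∀ {z}, z ∉ q.clique → z ∉ q₀.clique := by simp [hc]
  refine ⟨fun z hz => ⟨hv ▸ (hZ z hz).1, hcl (hZ z hz).2⟩, fun v k hk => ?_, I, fun v k hk => ?_,
    fun v k hk v' k' hk' => hd v k (Finset.mem_of_mem_erase hk) v' k' (Finset.mem_of_mem_erase hk')⟩
  · rw [Finset.mem_erase] at hk
    have := hT v k hk.2
    simpa [hc, hk.1] using this
  · have := hI v k (Finset.mem_of_mem_erase hk)
    rw [hv, hg] at this
    exact ⟨fun z hz => ⟨(this.1 z hz).1, hcl (this.1 z hz).2.1, (this.1 z hz).2.2⟩, this.2⟩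

/-- The part of a link to the vertex `w` that is taken out of the clique lies in `G`. -/
theorem conn_of_adds {v : V} {A : Set V} (hq₀ : Derives (.start G) q₀) (hw : AddsVertex q₀ q w)
    (hA : ∀ z ∈ A, z ∉ q.clique) (hv : v ∉ q.clique)
    (h : ∃ x, Conn G (insert v A) v x ∧ q.graph.Adj x w) : Conn G (insert w (insert v A)) v w := by
  obtain ⟨x, hx, hxw⟩ := h
  obtain ⟨hwv, hwc, hwa, -, hg, hc⟩ := hw
  have hxc : x ∉ q.clique := by
    rcases hx.right_mem with rfl | h
    exacts [hv, hA x h]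
  refine (hx.mono (Set.subset_insert _ _)).trans (.of_adj (hq₀.adj ?_ hwc (hg ▸ hxw))
    (Set.mem_insert_of_mem _ hx.right_mem) (Set.mem_insert _ _))
  rw [hc, List.mem_cons, not_or] at hxc
  exact hxc.2

open scoped Classical in
/-- Undoing the addition of `w`, the link from `p` to `w` being extended to a vertex `k` of the
clique. -/
theorem reroute {p k : V} (h : Joined G q Z T) (hq₀ : Derives (.start G) q₀)
    (hw : AddsVertex q₀ q w) (hp : w ∈ T p) (hk : k ∈ q₀.clique) (hkp : k ∉ T p) :
    Joined G q₀ Z fun v => if v = p then insert k ((T p).erase w) else (T v).erase w := by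
  have he := h.erase hw
  obtain ⟨hZ, hT, I, hI, hd⟩ := h
  have hpZ := (hT p w hp).1
  have hpw := conn_of_adds hq₀ hw (fun z hz => ((hI p w hp).1 z hz).2.1) (hZ p hpZ).2 (hI p w hp).2
  obtain ⟨hwv, hwc, hwa, hv, hg, hc⟩ := hw
  have hwq : w ∈ q.clique := by simp [hc]
  have hwI : ∀ v, ∀ l ∈ T v, w ∉ I v l := fun v l hl h => ((hI v l hl).1 w h).2.1 hwq
  have hmem : ∀ {v l}, l ∈ (if v = p then insert k ((T p).erase w) else (T v).erase w) →
      (v = p ∧ l = k) ∨ (¬ (v = p ∧ l = k) ∧ l ≠ w ∧ l ∈ T v) := by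
    intro v l hl
    split_ifs at hl with hvp
    · subst hvp
      rcases Finset.mem_insert.1 hl with rfl | hl
      · exact .inl ⟨rfl, rfl⟩
      · by_cases hlk : l = k
        · exact .inl ⟨rfl, hlk⟩
        · exact .inr ⟨by simp [hlk], (Finset.mem_erase.1 hl)⟩
    · exact .inr ⟨by simp [hvp], Finset.mem_erase.1 hl⟩
  refine ⟨he.1, fun v l hl => ?_, fun v l => if v = p ∧ l = k then insert w (I p w) else I v l,
    fun v l hl => ?_, fun v l hl v' l' hl' hne => ?_⟩
  · rcases hmem hl with ⟨rfl, rfl⟩ | ⟨-, h1, h2⟩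
    · exact ⟨hpZ, hk⟩
    · exact he.2.1 v l (Finset.mem_erase.2 ⟨h1, h2⟩)
  · have hcl : ∀ {z}, z ∉ q.clique → z ∉ q₀.clique := by simp [hc]
    rcases hmem hl with ⟨rfl, rfl⟩ | ⟨hvl, h1, h2⟩
    · simp only [and_self, if_true]
      refine ⟨fun z hz => ?_, w, ?_, hwa l hk⟩
      · rcases hz with rfl | hz
        · exact ⟨hwv, hwc, fun h => (hZ z h).2 hwq⟩
        · have := (hI v w hp).1 z hz
          exact ⟨hv ▸ this.1, hcl this.2.1, this.2.2⟩
      · rwa [Set.insert_comm]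
    · simp only [if_neg hvl]
      have := hI v l h2
      rw [hv, hg] at this
      exact ⟨fun z hz => ⟨(this.1 z hz).1, hcl (this.1 z hz).2.1, (this.1 z hz).2.2⟩, this.2⟩
  · rcases hmem hl with ⟨rfl, rfl⟩ | ⟨hvl, h1, h2⟩ <;>
      rcases hmem hl' with ⟨rfl, rfl⟩ | ⟨hvl', h1', h2'⟩
    · simp at hne
    · simp only [and_self, if_true, if_neg hvl']
      rw [Set.disjoint_insert_left]
      exact ⟨hwI v' l' h2', hd v w hp v' l' h2' (by simp [h1'.symm])⟩
    · simp only [and_self, if_true, if_neg hvl]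
      rw [Set.disjoint_insert_right]
      exact ⟨hwI v l h2, hd v l h2 v' w hp (by simp [h1])⟩
    · simp only [if_neg hvl, if_neg hvl']
      exact hd v l h2 v' l' h2' hne

open scoped Classical in
/-- Undoing the addition of `w`, with `w` as a new terminal that is linked to the whole remaining
clique. The links to `w` become paths of `G`, with interiors in `Y`, that can be added to
every linkage avoiding `Y`. -/
theorem branch (h : Joined G q Z T) (hq₀ : Derives (.start G) q₀) (hw : AddsVertex q₀ q w) :
    w ∉ Z ∧ ∃ Y : Set V,
      Joined G q₀ (insert w Z ∪ Y)
        (fun v => if v = w then q₀.clique.toFinset else (T v).erase w) ∧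
      Disjoint (insert w Z) Y ∧
      ∀ Z' E, Y ⊆ Z' → Linkage G Z' E →
        Linkage G (Z' \ Y) (E ∪ {e | ∃ v, w ∈ T v ∧ e = s(w, v)}) := by
  have he := h.erase hw
  obtain ⟨hZ, hT, I, hI, hd⟩ := h
  have hconn : ∀ v, w ∈ T v → Conn G (insert w (insert v (I v w))) v w := fun v hv =>
    conn_of_adds hq₀ hw (fun z hz => ((hI v w hv).1 z hz).2.1) (hZ v (hT v w hv).1).2 (hI v w hv).2
  obtain ⟨hwv, hwc, hwa, hv, hg, hc⟩ := hw
  have hwq : w ∈ q.clique := by simp [hc]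
  have hwZ : w ∉ Z := fun h => (hZ w h).2 hwq
  have hwI : ∀ v, ∀ l ∈ T v, w ∉ I v l := fun v l hl h => ((hI v l hl).1 w h).2.1 hwq
  have hcl : ∀ {z}, z ∉ q.clique → z ∉ q₀.clique := by simp [hc]
  let Y : Set V := {z | ∃ v, w ∈ T v ∧ z ∈ I v w}
  refine ⟨hwZ, Y, ⟨fun z hz => ?_, fun v k hk => ?_,
    fun v k => if v = w then ∅ else I v k, fun v k hk => ?_, fun v k hk v' k' hk' hne => ?_⟩,
    ?_, fun Z' E hY hE => ?_⟩
  · rcases hz with (rfl | hz) | ⟨v, hvw, hz⟩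
    · exact ⟨hwv, hwc⟩
    · exact he.1 z hz
    · exact ⟨hv ▸ ((hI v w hvw).1 z hz).1, hcl ((hI v w hvw).1 z hz).2.1⟩
  · beta_reduce at hk
    split_ifs at hk with hvw
    · exact ⟨.inl (.inl hvw), by simpa using hk⟩
    · exact ⟨.inl (.inr (he.2.1 v k hk).1), (he.2.1 v k hk).2⟩
  · beta_reduce at hk ⊢
    split_ifs at hk ⊢ with hvw
    · subst hvw
      exact ⟨by simp, v, .refl (by simp), hwa k (by simpa using hk)⟩
    · rw [Finset.mem_erase] at hk
      have := hI v k hk.2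
      rw [hv, hg] at this
      refine ⟨fun z hz => ⟨(this.1 z hz).1, hcl (this.1 z hz).2.1, ?_⟩, this.2⟩
      rintro ((rfl | h) | ⟨v', hv', h⟩)
      · exact hwI v k hk.2 hz
      · exact (this.1 z hz).2.2 h
      · exact Set.disjoint_left.1 (hd v k hk.2 v' w hv' (by simp [hk.1])) hz h
  · beta_reduce at hk hk' ⊢
    split_ifs at hk hk' ⊢ <;> try simp
    exact hd v k (Finset.mem_of_mem_erase hk) v' k' (Finset.mem_of_mem_erase hk') hne
  · rw [Set.disjoint_left]
    rintro z (rfl | hz) ⟨v, hvw, hzI⟩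
    · exact hwI v _ hvw hzI
    · exact ((hI v w hvw).1 z hzI).2.2 hz
  · obtain ⟨J, h1, h2, h3⟩ := hE
    let J' : Sym2 V → Set V := fun e =>
      if e ∈ E then J e else {z | ∃ v, w ∈ T v ∧ e = s(w, v) ∧ z ∈ I v w}
    have hJ'Y : ∀ e ∉ E, J' e ⊆ Y := by
      intro e he z hz
      simp only [J', if_neg he] at hz
      obtain ⟨v, hv, -, hz⟩ := hz
      exact ⟨v, hv, hz⟩
    have hJ' : ∀ e ∈ E, J' e = J e := fun e he => if_pos he
    refine ⟨J', fun x y hxy => ?_, fun e he => ?_, fun e he e' he' hne => ?_⟩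
    · by_cases hs : s(x, y) ∈ E
      · rw [hJ' _ hs]
        exact h1 x y hs
      · obtain ⟨v, hv, he⟩ := hxy.resolve_left hs
        have hsub : insert w (insert v (I v w)) ⊆ J' s(x, y) ∪ {w, v} := by
          rintro z (rfl | rfl | hz)
          · simp
          · simp
          · left
            simp only [J', if_neg hs]
            exact ⟨v, hv, he, hz⟩
        rcases Sym2.eq_iff.1 he with ⟨rfl, rfl⟩ | ⟨rfl, rfl⟩
        · exact (hconn y hv).symm.mono hsub
        · exact (hconn x hv).mono (by rwa [Set.pair_comm x y])
    · by_cases hs : e ∈ E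
      · rw [hJ' _ hs]
        exact (h2 e hs).mono_right Set.sdiff_subset
      · exact Set.disjoint_sdiff_right.mono_left (hJ'Y e hs)
    · by_cases hs : e ∈ E <;> by_cases hs' : e' ∈ E
      · rw [hJ' _ hs, hJ' _ hs']
        exact h3 e hs e' hs' hne
      · rw [hJ' _ hs]
        exact (h2 e hs).mono_right ((hJ'Y e' hs').trans hY)
      · rw [hJ' _ hs']
        exact ((h2 e' hs').mono_right ((hJ'Y e hs).trans hY)).symm
      · rw [Set.disjoint_left]
        intro z hz hz'
        simp only [J', if_neg hs, if_neg hs'] at hz hz'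
        obtain ⟨v, hv, rfl, hz⟩ := hz
        obtain ⟨v', hv', rfl, hz'⟩ := hz'
        refine Set.disjoint_left.1 (hd v w hv v' w hv' ?_) hz hz'
        rintro ⟨⟩
        exact hne rfl

end Joined

/-! ### Undoing the deletion of a vertex -/

/-- The vertices in `N` can be shifted to earlier places in the list `v :: L`, each of them to `v`
or to an element of `N`. -/
theorem exists_shift {v : V} {L : List V} (hL : (v :: L).Nodup) (N : Finset V)
    (hN : ∀ k ∈ N, k ∈ L) :
    ∃ π : V → V, Set.InjOn π N ∧ ∀ k ∈ N, (π k = v ∨ π k ∈ N) ∧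
      ∀ A B, v :: L = A ++ k :: B → π k ∈ A := by
  classical
  induction L generalizing v N with
  | nil =>
    refine ⟨id, Set.injOn_id _, fun k hk => ?_⟩
    simpa using hN k hk
  | cons k₀ L ih =>
    simp only [List.nodup_cons, List.mem_cons, not_or] at hL
    obtain ⟨⟨hvk, hvL⟩, hkL, hLn⟩ := hL
    by_cases hk : k₀ ∈ N
    · obtain ⟨π, hπ, h⟩ := ih (v := k₀) (by simp [hkL, hLn]) (N.erase k₀) (fun k hk' => by
        rw [Finset.mem_erase] at hk'
        exact (List.mem_cons.1 (hN k hk'.2)).resolve_left hk'.1)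
      have hπN : ∀ k ∈ N, k ≠ k₀ → π k ∈ N := by
        intro k hkN hne
        rcases (h k (Finset.mem_erase.2 ⟨hne, hkN⟩)).1 with h | h
        exacts [h ▸ hk, Finset.mem_of_mem_erase h]
      have hvN : v ∉ N := fun h => (List.mem_cons.1 (hN v h)).elim hvk hvL
      refine ⟨fun k => if k = k₀ then v else π k, fun x hx y hy hxy => ?_, fun k hkN => ⟨?_, ?_⟩⟩
      · beta_reduce at hxy
        split_ifs at hxy with h1 h2 h2
        · rw [h1, h2]
        · exact absurd (hxy ▸ hπN y hy h2) hvN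
        · exact absurd (hxy ▸ hπN x hx h1) hvN
        · exact hπ (by simp_all) (by simp_all) hxy
      · beta_reduce
        split_ifs with h1
        exacts [.inl rfl, .inr (hπN k hkN h1)]
      · intro A B hAB
        beta_reduce
        rcases A with _ | ⟨a, A⟩
        · simp only [List.nil_append, List.cons.injEq] at hAB
          exact absurd (hAB.1 ▸ hkN) hvN
        · simp only [List.cons_append, List.cons.injEq] at hAB
          split_ifs with h1
          · simp [hAB.1]
          · exact List.mem_cons_of_mem _ ((h k (Finset.mem_erase.2 ⟨h1, hkN⟩)).2 A B hAB.2)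
    · obtain ⟨π, hπ, h⟩ := ih (v := v) (by simp [hvL, hLn]) N (fun k hk' =>
        (List.mem_cons.1 (hN k hk')).resolve_left fun h => hk (h ▸ hk'))
      refine ⟨π, hπ, fun k hkN => ⟨(h k hkN).1, ?_⟩⟩
      rintro (_ | ⟨a, _ | ⟨a', A⟩⟩) B hAB
      · simp only [List.nil_append, List.cons.injEq] at hAB
        exact absurd (hN k hkN) (by simp [← hAB.1, hvk, hvL])
      · simp only [List.cons_append, List.nil_append, List.cons.injEq] at hAB
        exact absurd (hAB.2.1 ▸ hkN) hk
      · simp only [List.cons_append, List.cons.injEq] at hAB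
        have := (h k hkN).2 (a :: A) B (by simp [hAB.1, hAB.2.2])
        simp only [List.mem_cons] at this ⊢
        tauto

/-- Replacing the ends of the links by an injection `τ u` for every terminal `u`. -/
theorem Joined.mapEnds {G : SimpleGraph V} {q₀ q : CliquePair V} {Z : Set V} {T : V → Finset V}
    (h : Joined G q Z T) (hv : q.verts ⊆ q₀.verts)
    (hc : ∀ z ∈ q.verts, z ∉ q.clique → z ∉ q₀.clique)
    (hτ : ∀ I : V → V → Set V,
      (∀ u, ∀ k ∈ T u, ∀ z ∈ insert u (I u k), z ∈ q.verts ∧ z ∉ q.clique) →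
      (∀ u, ∀ k ∈ T u, ∃ x, Conn G (insert u (I u k)) u x ∧ q.graph.Adj x k) →
      ∀ u, ∃ τ : V → V, Set.InjOn τ (T u) ∧ ∀ k ∈ T u, τ k ∈ q₀.clique ∧
        ∃ x, Conn G (insert u (I u k)) u x ∧ q₀.graph.Adj x (τ k)) :
    ∃ T₀, Joined G q₀ Z T₀ ∧ ∀ u, (T₀ u).card = (T u).card := by
  classical
  obtain ⟨hZ, hT, I, hI, hd⟩ := h
  have hIv : ∀ u, ∀ k ∈ T u, ∀ z ∈ insert u (I u k), z ∈ q.verts ∧ z ∉ q.clique := by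
    rintro u k hk z (rfl | hz)
    exacts [hZ _ (hT _ k hk).1, ⟨((hI u k hk).1 z hz).1, ((hI u k hk).1 z hz).2.1⟩]
  choose τ hτi hτ using hτ I hIv (fun u k hk => (hI u k hk).2)
  have hinv : ∀ u, ∀ k₀ ∈ (T u).image (τ u), ∃ k ∈ T u, τ u k = k₀ := fun u k₀ h => by
    simpa using h
  choose! σ hσ hσ' using hinv
  refine ⟨fun u => (T u).image (τ u), ⟨fun z hz => ⟨hv (hZ z hz).1, hc z (hZ z hz).1 (hZ z hz).2⟩,
    fun u k hk => ?_, fun u k => I u (σ u k), fun u k hk => ?_,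
    fun u k hk u' k' hk' hne => hd u _ (hσ u k hk) u' _ (hσ u' k' hk') ?_⟩,
    fun u => Finset.card_image_of_injOn (hτi u)⟩
  · have := (hτ u _ (hσ u k hk)).1
    rw [hσ' u k hk] at this
    exact ⟨(hT u _ (hσ u k hk)).1, this⟩
  · have h1 := hI u _ (hσ u k hk)
    have h2 := (hτ u _ (hσ u k hk)).2
    rw [hσ' u k hk] at h2
    exact ⟨fun z hz => ⟨hv (h1.1 z hz).1, hc z (h1.1 z hz).1 (h1.1 z hz).2.1, (h1.1 z hz).2.2⟩, h2⟩
  · rintro heq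
    rw [Prod.mk.injEq] at heq
    obtain ⟨rfl, heq⟩ := heq
    exact hne (by rw [← hσ' u k hk, ← hσ' u k' hk', heq])

/-- Undoing the deletion of the vertex `v`: the links of a terminal that end with new edges, to
`k₁ < k₂ < …` in the order of the clique, are led to `v, k₁, k₂, …` instead. The last but one
vertex of the link to `kᵢ` has `kᵢ` as its first non-neighbour, so the required edges exist. -/
theorem Joined.of_deletes {G : SimpleGraph V} {q₀ q : CliquePair V} {Z : Set V} {T : V → Finset V}
    {v : V} (h : Joined G q Z T) (hv : DeletesVertex q₀ q v) :
    ∃ T₀, Joined G q₀ Z T₀ ∧ ∀ u, (T₀ u).card = (T u).card := by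
  classical
  obtain ⟨-, -, hc, hverts, hg⟩ := hv
  have hT := h.2.1
  have hclq : ∀ z ∈ q.verts, z ∉ q.clique → z ∉ q₀.clique := by
    intro z hz hzc
    rw [hverts] at hz
    rw [hc, List.mem_cons, not_or]
    exact ⟨hz.2, hzc⟩
  refine h.mapEnds (hverts ▸ Set.sdiff_subset) hclq fun I hI hx u => ?_
  choose! x hx hxk using hx u
  let N := {k ∈ T u | ¬ q₀.graph.Adj (x k) k}
  have hnew : ∀ k ∈ N, q₀.graph.Adj v (x k) ∧ IsFirstNonNeighbor q₀.graph q₀.clique (x k) k := by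
    intro k hk
    obtain ⟨hk, hna⟩ := Finset.mem_filter.1 hk
    rcases ((hg _ _).1 (hxk k hk)).2.2 with h | h | h
    · exact absurd h hna
    · exact ⟨h.1, h.2.2⟩
    · exact absurd (by simp [hc, (hT u k hk).2]) h.2.1
  obtain ⟨π, hπ, hπN⟩ := exists_shift (v := v) (L := q.clique) (hc ▸ q₀.nodup) N
    (fun k hk => (hT u k (Finset.mem_filter.1 hk).1).2)
  have hvT : v ∉ T u := fun h => by
    have := q.clique_verts v (hT u v h).2
    simp [hverts] at this
  have hvN : v ∉ N := fun h => hvT (Finset.mem_filter.1 h).1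
  refine ⟨fun k => if k ∈ N then π k else k, fun k hk l hl hkl => ?_, fun k hk => ?_⟩
  · beta_reduce at hkl
    split_ifs at hkl with h1 h2 h2
    · exact hπ h1 h2 hkl
    · rcases (hπN k h1).1 with h | h
      · exact absurd (h ▸ hkl ▸ hl) hvT
      · exact absurd (hkl ▸ h) h2
    · rcases (hπN l h2).1 with h | h
      · exact absurd (h ▸ hkl ▸ hk) hvT
      · exact absurd (hkl ▸ h) h1
    · exact hkl
  · beta_reduce
    split_ifs with h1
    · obtain ⟨A, B, hAB, hA, -⟩ := (hnew k h1).2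
      have hmem := (hπN k h1).2 A B (hc ▸ hAB)
      exact ⟨by simp [hAB, hmem], x k, hx k hk, hA _ hmem⟩
    · refine ⟨by simp [hc, (hT u k hk).2], x k, hx k hk, ?_⟩
      by_contra hna
      exact h1 (Finset.mem_filter.2 ⟨hk, hna⟩)

/-! ### The induction principle -/

/-- The edges from `w` to the vertices `u i` with `i ∈ S`. -/
def star (w : V) {t : ℕ} (u : Fin t → V) (S : Set (Fin t)) : Set (Sym2 V) :=
  {e | ∃ i ∈ S, e = s(w, u i)}

theorem mem_star {w : V} {t : ℕ} {u : Fin t → V} {S : Set (Fin t)} {i : Fin t} (hi : i ∈ S) :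
    s(w, u i) ∈ star w u S :=
  ⟨i, hi, rfl⟩

theorem mem_star_swap {w : V} {t : ℕ} {u : Fin t → V} {S : Set (Fin t)} {i : Fin t} (hi : i ∈ S) :
    s(u i, w) ∈ star w u S :=
  ⟨i, hi, Sym2.eq_swap⟩

open scoped Classical in
/-- The situation after undoing the addition of a vertex `w` that is linked to at least two of the
vertices `u i`: the indices of these are the elements of `S`. The vertex `w` is a new
terminal with at least as many links as any other vertex, and every linkage that avoids `Z'`
can be enlarged by paths from `w` to the vertices `u i` with `i ∈ S`. -/
structure Branches (G : SimpleGraph V) (q₀ : CliquePair V) (Z : Set V) {t : ℕ} (u : Fin t → V)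
    (W : Fin t → ℕ) (w : V) (S : Set (Fin t)) (Z' : Set V) (T' : V → Finset V) : Prop where
  joined : Joined G q₀ Z' T'
  inj : Function.Injective u
  mem : ∀ i, u i ∈ Z
  notMem : w ∉ Z
  two : ∃ i ∈ S, ∃ j ∈ S, i ≠ j
  card_le : ∀ v, (T' v).card ≤ (T' w).card
  card : ∀ i, W i ≤ (T' (u i)).card + if i ∈ S then 1 else 0
  subset : insert w Z ⊆ Z'
  lift : ∀ (B : Set V) (E : Set (Sym2 V)), Disjoint B Z' → Linkage G (B ∪ Z') E →
    Linkage G (B ∪ insert w Z) (E ∪ star w u S)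

namespace Branches

variable {G : SimpleGraph V} {q₀ : CliquePair V} {Z : Set V} {t : ℕ} {u : Fin t → V}
  {W : Fin t → ℕ} {w : V} {S : Set (Fin t)} {Z' : Set V} {T' : V → Finset V}

theorem ne (h : Branches G q₀ Z u W w S Z' T') (i : Fin t) : w ≠ u i := by
  rintro rfl
  exact h.notMem (h.mem i)

theorem ne_new (h : Branches G q₀ Z u W w S Z' T') {b : V} (hb : b ∉ Z') : w ≠ b := by
  rintro rfl
  exact hb (h.subset (Set.mem_insert _ _))

theorem notMem_of_new (h : Branches G q₀ Z u W w S Z' T') {b : V} (hb : b ∉ Z') : b ∉ Z :=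
  fun hbZ => hb (h.subset (Set.mem_insert_of_mem _ hbZ))

/-- The vertex `w` becomes a branch vertex. -/
theorem keep (h : Branches G q₀ Z u W w S Z' T') {B : Set V} {E E' : Set (Sym2 V)}
    (hB : Disjoint B Z') (hL : Linkage G (B ∪ Z') E) (hE : E' ⊆ E ∪ star w u S) :
    Linkage G (insert w B ∪ Z) E' :=
  (h.lift B E hB hL).mono (by rw [Set.union_insert, Set.insert_union]) hE

theorem keep₀ (h : Branches G q₀ Z u W w S Z' T') {E E' : Set (Sym2 V)}
    (hL : Linkage G Z' E) (hE : E' ⊆ E ∪ star w u S) : Linkage G ({w} ∪ Z) E' := by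
  simpa using h.keep (Set.empty_disjoint Z') (by simpa using hL) hE

/-- The vertex `w` becomes an inner vertex of a path for `xy`. -/
theorem suppress (h : Branches G q₀ Z u W w S Z' T') {B : Set V} {E E' : Set (Sym2 V)} {x y : V}
    (hB : Disjoint B Z') (hL : Linkage G (B ∪ Z') E) (hx : s(w, x) ∈ E ∪ star w u S)
    (hy : s(w, y) ∈ E ∪ star w u S)
    (hE : E' ⊆ insert s(x, y) {e ∈ E ∪ star w u S | w ∉ e}) : Linkage G (B ∪ Z) E' := by
  have hL' := h.lift B E hB hL
  rw [Set.union_insert] at hL'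
  refine hL'.suppress ?_ hx hy hE
  rintro (hw | hw)
  exacts [Set.disjoint_left.1 hB hw (h.subset (Set.mem_insert _ _)), h.notMem hw]

theorem suppress₀ (h : Branches G q₀ Z u W w S Z' T') {E E' : Set (Sym2 V)} {x y : V}
    (hL : Linkage G Z' E) (hx : s(w, x) ∈ E ∪ star w u S) (hy : s(w, y) ∈ E ∪ star w u S)
    (hE : E' ⊆ insert s(x, y) {e ∈ E ∪ star w u S | w ∉ e}) : Linkage G Z E' := by
  simpa using h.suppress (Set.empty_disjoint Z') (by simpa using hL) hx hy hE

end Branches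

open scoped Classical in
theorem Joined.branches {G : SimpleGraph V} {q₀ q : CliquePair V} {Z : Set V} {T : V → Finset V}
    {w : V} {t : ℕ} {u : Fin t → V} {W : Fin t → ℕ} (h : Joined G q Z T)
    (hq₀ : Derives (.start G) q₀) (hw : AddsVertex q₀ q w) (hu : Function.Injective u)
    (hpos : ∀ i, 0 < W i) (hW : ∀ i, W i ≤ (T (u i)).card)
    (htwo : ∃ i, w ∈ T (u i) ∧ ∃ j, w ∈ T (u j) ∧ i ≠ j) :
    ∃ Z' T', Branches G q₀ Z u W w {i | w ∈ T (u i)} Z' T' := by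
  have hT := (h.erase hw).2.1
  obtain ⟨hwZ, Y, hJ, hY, hlift⟩ := h.branch hq₀ hw
  refine ⟨_, _, ⟨hJ, hu, fun i => h.mem_of_card_pos ((hpos i).trans_le (hW i)), hwZ, htwo,
    fun v => ?_, fun i => ?_,
    Set.subset_union_left, fun B E hB hL => ?_⟩⟩
  · rw [if_pos rfl]
    split_ifs with hvw
    · exact le_rfl
    · exact Finset.card_le_card fun k hk => by simpa using (hT v k hk).2
  · have hi := hW i
    have hwi : u i ≠ w := by
      rintro hwi
      exact hwZ (hwi ▸ h.mem_of_card_pos ((hpos i).trans_le hi))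
    rw [if_neg hwi]
    by_cases hiS : w ∈ T (u i)
    · rw [if_pos (by exact hiS), Finset.card_erase_of_mem hiS]
      omega
    · rwa [Finset.erase_eq_of_notMem hiS, if_neg (by exact hiS)]
  · refine (hlift _ E (Set.subset_union_right.trans Set.subset_union_right) hL).mono ?_ ?_
    · refine Set.subset_sdiff.2 ⟨Set.union_subset_union_right _ Set.subset_union_left, ?_⟩
      exact Set.disjoint_union_left.2 ⟨hB.mono_right Set.subset_union_right, hY⟩
    · intro e he
      rcases he with h | ⟨i, hi, rfl⟩
      exacts [.inl h, .inr ⟨u i, hi, rfl⟩]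

/-- To prove that suitable links from vertices `u i` force some structure it suffices to
consider the removal from the clique of a vertex `w` that is linked to at least two of them. If only
one of them is linked to `w` then its link can be rerouted through `w`, because by `tie`
there is a free vertex in the remaining clique. -/
theorem forced_of_branches {G : SimpleGraph V} {t : ℕ} [NeZero t] (W : Fin t → ℕ)
    (pos : ∀ i, 0 < W i) (tie : ∀ i, ∃ j, j ≠ i ∧ W i ≤ W j) (Goal : Set V → (Fin t → V) → Prop)
    (hit : ∀ q₀, Derives (.start G) q₀ →
      (∀ Z T u, Joined G q₀ Z T → Function.Injective u → (∀ i, W i ≤ (T (u i)).card) → Goal Z u) →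
      ∀ Z u w S Z' T', Branches G q₀ Z u W w S Z' T' → Goal Z u)
    {q : CliquePair V} (hq : Derives (.start G) q) {Z : Set V} {T : V → Finset V} {u : Fin t → V}
    (hJ : Joined G q Z T) (hu : Function.Injective u) (hW : ∀ i, W i ≤ (T (u i)).card) :
    Goal Z u := by
  classical
  induction hq generalizing Z T u with
  | refl =>
    obtain ⟨k, hk⟩ := Finset.card_pos.1 ((pos 0).trans_le (hW 0))
    exact absurd (hJ.2.1 _ k hk).2 List.not_mem_nil
  | @tail q₀ q hq₀ hs ih =>
    rcases hs with ⟨w, hw⟩ | ⟨v, hv⟩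
    swap
    · obtain ⟨T₀, hT₀, hc⟩ := hJ.of_deletes hv
      exact ih hT₀ hu fun i => by simpa [hc] using hW i
    by_cases htwo : ∃ i, w ∈ T (u i) ∧ ∃ j, w ∈ T (u j) ∧ i ≠ j
    · obtain ⟨Z', T', hB⟩ := hJ.branches hq₀ hw hu pos hW htwo
      exact hit q₀ hq₀ (fun Z T u => ih) Z u w _ Z' T' hB
    by_cases hone : ∃ i, w ∈ T (u i)
    swap
    · refine ih (hJ.erase hw) hu fun i => ?_
      rw [Finset.erase_eq_of_notMem fun h => hone ⟨i, h⟩]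
      exact hW i
    obtain ⟨i, hi⟩ := hone
    have hne : ∀ j, j ≠ i → w ∉ T (u j) := fun j hj h => htwo ⟨i, hi, j, h, hj.symm⟩
    by_cases hk : ∃ k ∈ q₀.clique, k ∉ T (u i)
    · obtain ⟨k, hk, hki⟩ := hk
      refine ih (hJ.reroute hq₀ hw hi hk hki) hu fun j => ?_
      by_cases hj : j = i
      · subst hj
        rw [if_pos rfl, Finset.card_insert_of_notMem (by simp [hki]), Finset.card_erase_of_mem hi]
        have := hW j
        omega
      · rw [if_neg (hu.ne hj), Finset.erase_eq_of_notMem (hne j hj)]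
        exact hW j
    · push Not at hk
      refine ih (hJ.erase hw) hu fun j => ?_
      by_cases hj : j = i
      · subst hj
        -- some other terminal needs as many links, which all go to the remaining clique
        obtain ⟨l, hl, hjl⟩ := tie j
        refine hjl.trans ((hW l).trans (Finset.card_le_card fun k hkl => ?_))
        have hkw : k ≠ w := by
          rintro rfl
          exact hne l hl hkl
        have := (hJ.2.1 _ k hkl).2
        rw [hw.2.2.2.2.2, List.mem_cons] at this
        exact Finset.mem_erase.2 ⟨hkw, hk k (this.resolve_left hkw)⟩
      · rw [Finset.erase_eq_of_notMem (hne j hj)]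
        exact hW j

/-! ### Comparison with joining paths -/

theorem mem_verts_of_mem_support {q : CliquePair V} {x y z : V} (p : q.graph.Walk x y)
    (hx : x ∈ q.verts) (hz : z ∈ p.support) : z ∈ q.verts := by
  induction p with
  | nil => simp_all
  | cons h p ih =>
    rcases List.mem_cons.1 hz with rfl | hz
    exacts [hx, ih (q.mem_verts _ _ h.symm) hz]

theorem IsJoined.joined {G : SimpleGraph V} {q : CliquePair V} (hq : Derives (.start G) q) {t : ℕ}
    {u : Fin t → V} {n : Fin t → ℕ} (h : IsJoined q u n) :
    ∃ T : V → Finset V, Joined G q (Set.range u) T ∧ ∀ i, (T (u i)).card = n i := by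
  classical
  obtain ⟨hu, huv, T, hcard, hT, P, hP, hdis, hdis'⟩ := h
  let T' : V → Finset V := Function.extend u T fun _ => ∅
  have hT' : ∀ i, T' (u i) = T i := fun i => hu.extend_apply _ _ _
  have hmem : ∀ {v k}, k ∈ T' v → ∃ i, u i = v ∧ k ∈ T i := by
    intro v k hk
    by_cases hv : ∃ i, u i = v
    · obtain ⟨i, rfl⟩ := hv
      exact ⟨i, rfl, hT' i ▸ hk⟩
    · simp [T', Function.extend_apply' _ _ _ hv] at hk
  let I : V → V → Set V := fun v k => {z | ∃ i, ∃ h : k ∈ T i, u i = v ∧ z ∈ interior (P i k h)}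
  have hI : ∀ i k (h : k ∈ T i), I (u i) k = interior (P i k h) := by
    intro i k h
    ext z
    refine ⟨?_, fun hz => ⟨i, h, rfl, hz⟩⟩
    rintro ⟨j, h', hj, hz⟩
    cases hu hj
    exact hz
  refine ⟨T', ⟨?_, fun v k hk => ?_, I, fun v k hk => ?_, fun v k hk v' k' hk' hne => ?_⟩,
    fun i => by rw [hT', hcard]⟩
  · rintro _ ⟨i, rfl⟩
    exact huv i
  · obtain ⟨i, rfl, hi⟩ := hmem hk
    exact ⟨⟨i, rfl⟩, hT i k hi⟩
  · replace hk := hmem hk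
    obtain ⟨i, rfl, hk⟩ := hk
    rw [hI i k hk]
    have hd := Set.disjoint_left.1 (hdis i k hk)
    have hint : ∀ z ∈ interior (P i k hk), z ∈ q.verts ∧ z ∉ q.clique ∧ z ∉ Set.range u :=
      fun z hz => ⟨mem_verts_of_mem_support _ (huv i).1 hz.1, fun h => hd hz (.inr h),
        fun h => hd hz (.inl h)⟩
    refine ⟨hint, (P i k hk).penultimate, ?_⟩
    have huk : u i ≠ k := fun h => (huv i).2 (h ▸ hT i k hk)
    have hnil : ¬ (P i k hk).Nil := fun h => huk h.eq
    refine ⟨?_, (P i k hk).adj_penultimate hnil⟩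
    have hsupp : ∀ z ∈ (P i k hk).dropLast.support, z ∈ insert (u i) (interior (P i k hk)) := by
      intro z hz
      by_cases hzu : z = u i
      · exact .inl hzu
      have hn := (hP i k hk).support_nodup
      rw [← SimpleGraph.Walk.dropLast_support_concat, List.nodup_append] at hn
      rw [SimpleGraph.Walk.support_dropLast hnil] at hz
      exact .inr ⟨List.dropLast_subset _ hz, hzu, hn.2.2 z hz k (by simp)⟩
    have hout : ∀ z ∈ (P i k hk).dropLast.support, z ∉ q.clique := by
      intro z hz
      rcases hsupp z hz with rfl | hz
      exacts [(huv i).2, (hint z hz).2.1]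
    refine ⟨(P i k hk).dropLast.transfer G fun e he => ?_, fun z hz => hsupp z (by simpa using hz)⟩
    induction e with | _ x y => 
    exact hq.adj (hout _ (SimpleGraph.Walk.fst_mem_support_of_mem_edges _ he))
      (hout _ (SimpleGraph.Walk.snd_mem_support_of_mem_edges _ he))
      (SimpleGraph.Walk.adj_of_mem_edges _ he)
  · replace hk := hmem hk
    obtain ⟨i, rfl, hk⟩ := hk
    replace hk' := hmem hk'
    obtain ⟨j, rfl, hk'⟩ := hk'
    rw [hI i k hk, hI j k' hk']
    exact hdis' i k hk j k' hk' fun h => hne (by cases h; rfl)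

/-! ### Auxiliary configurations -/

theorem injective_vec₂ {x y : V} (h : x ≠ y) : Function.Injective ![x, y] := by
  simp [Function.Injective, Fin.forall_fin_succ, h, h.symm]

theorem injective_vec₃ {x y z : V} (h : x ≠ y) (h' : x ≠ z) (h'' : y ≠ z) :
    Function.Injective ![x, y, z] := by
  simp [Function.Injective, Fin.forall_fin_succ, h, h.symm, h', h'.symm, h'', h''.symm]

theorem injective_vec₄ {x y z t : V} (h : x ≠ y) (h' : x ≠ z) (h'' : y ≠ z) (hx : x ≠ t)
    (hy : y ≠ t) (hz : z ≠ t) : Function.Injective ![x, y, z, t] := by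
  simp [Function.Injective, Fin.forall_fin_succ, h, h.symm, h', h'.symm, h'', h''.symm, hx,
    hx.symm, hy, hy.symm, hz, hz.symm]

theorem mem_of_two₂ {S : Set (Fin 2)} (h : ∃ i ∈ S, ∃ j ∈ S, i ≠ j) : 0 ∈ S ∧ 1 ∈ S := by
  obtain ⟨i, hi, j, hj, hij⟩ := h
  fin_cases i <;> fin_cases j <;> simp_all

namespace Branches

variable {G : SimpleGraph V} {q₀ : CliquePair V} {Z Z' : Set V} {w : V} {T' : V → Finset V}

/-- The facts about three terminals that are used below, according to the terminals linked to
`w`. -/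
theorem cases₃ {k₀ k₁ k₂ : ℕ} {u : Fin 3 → V} {S : Set (Fin 3)}
    (h : Branches G q₀ Z u ![k₀, k₁, k₂] w S Z' T') :
    (u 0 ≠ u 1 ∧ u 0 ≠ u 2 ∧ u 1 ≠ u 2) ∧ (w ≠ u 0 ∧ w ≠ u 1 ∧ w ≠ u 2) ∧
    ((T' (u 0)).card ≤ (T' w).card ∧ (T' (u 1)).card ≤ (T' w).card ∧
      (T' (u 2)).card ≤ (T' w).card) ∧
    (((0 ∈ S ∧ 1 ∈ S ∧ 2 ∈ S) ∧ k₀ ≤ (T' (u 0)).card + 1 ∧ k₁ ≤ (T' (u 1)).card + 1 ∧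
        k₂ ≤ (T' (u 2)).card + 1) ∨
      ((0 ∈ S ∧ 1 ∈ S) ∧ k₀ ≤ (T' (u 0)).card + 1 ∧ k₁ ≤ (T' (u 1)).card + 1 ∧
        k₂ ≤ (T' (u 2)).card) ∨
      ((0 ∈ S ∧ 2 ∈ S) ∧ k₀ ≤ (T' (u 0)).card + 1 ∧ k₁ ≤ (T' (u 1)).card ∧
        k₂ ≤ (T' (u 2)).card + 1) ∨
      ((1 ∈ S ∧ 2 ∈ S) ∧ k₀ ≤ (T' (u 0)).card ∧ k₁ ≤ (T' (u 1)).card + 1 ∧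
        k₂ ≤ (T' (u 2)).card + 1)) := by
  refine ⟨⟨h.inj.ne (by decide), h.inj.ne (by decide), h.inj.ne (by decide)⟩,
    ⟨h.ne 0, h.ne 1, h.ne 2⟩, ⟨h.card_le _, h.card_le _, h.card_le _⟩, ?_⟩
  have c0 : k₀ ≤ _ := h.card 0
  have c1 : k₁ ≤ _ := h.card 1
  have c2 : k₂ ≤ _ := h.card 2
  obtain ⟨i, hi, j, hj, hij⟩ := h.two
  by_cases h0 : 0 ∈ S <;> by_cases h1 : 1 ∈ S <;> by_cases h2 : 2 ∈ S <;>
    simp only [h0, h1, h2, if_true, if_false, add_zero] at c0 c1 c2 <;>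
    first
    | (simp [*]; done)
    | fin_cases i <;> fin_cases j <;> simp_all

/-- The facts about four terminals that are used below. -/
theorem cases₄ {k₀ k₁ k₂ k₃ : ℕ} {u : Fin 4 → V} {S : Set (Fin 4)}
    (h : Branches G q₀ Z u ![k₀, k₁, k₂, k₃] w S Z' T') :
    (u 0 ≠ u 1 ∧ u 0 ≠ u 2 ∧ u 0 ≠ u 3 ∧ u 1 ≠ u 2 ∧ u 1 ≠ u 3 ∧ u 2 ≠ u 3) ∧
    (w ≠ u 0 ∧ w ≠ u 1 ∧ w ≠ u 2 ∧ w ≠ u 3) ∧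
    ((T' (u 0)).card ≤ (T' w).card ∧ (T' (u 1)).card ≤ (T' w).card ∧
      (T' (u 2)).card ≤ (T' w).card ∧ (T' (u 3)).card ≤ (T' w).card) ∧
    (k₀ ≤ (T' (u 0)).card + 1 ∧ k₁ ≤ (T' (u 1)).card + 1 ∧ k₂ ≤ (T' (u 2)).card + 1 ∧
      k₃ ≤ (T' (u 3)).card + 1) ∧
    ((0 ∈ S ∨ 0 ∉ S ∧ k₀ ≤ (T' (u 0)).card) ∧ (1 ∈ S ∨ 1 ∉ S ∧ k₁ ≤ (T' (u 1)).card) ∧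
      (2 ∈ S ∨ 2 ∉ S ∧ k₂ ≤ (T' (u 2)).card) ∧ (3 ∈ S ∨ 3 ∉ S ∧ k₃ ≤ (T' (u 3)).card)) ∧
    ((0 ∈ S ∧ 1 ∈ S) ∨ (0 ∈ S ∧ 2 ∈ S) ∨ (0 ∈ S ∧ 3 ∈ S) ∨ (1 ∈ S ∧ 2 ∈ S) ∨ (1 ∈ S ∧ 3 ∈ S) ∨
      (2 ∈ S ∧ 3 ∈ S)) := by
  have hc : ∀ i, (![k₀, k₁, k₂, k₃] i ≤ (T' (u i)).card + 1) ∧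
      (i ∈ S ∨ i ∉ S ∧ ![k₀, k₁, k₂, k₃] i ≤ (T' (u i)).card) := by
    intro i
    have := h.card i
    split_ifs at this with hi
    · exact ⟨this, .inl hi⟩
    · exact ⟨this.trans (Nat.le_succ _), .inr ⟨hi, this⟩⟩
  refine ⟨⟨h.inj.ne (by decide), h.inj.ne (by decide), h.inj.ne (by decide), h.inj.ne (by decide),
    h.inj.ne (by decide), h.inj.ne (by decide)⟩, ⟨h.ne 0, h.ne 1, h.ne 2, h.ne 3⟩,
    ⟨h.card_le _, h.card_le _, h.card_le _, h.card_le _⟩,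
    ⟨(hc 0).1, (hc 1).1, (hc 2).1, (hc 3).1⟩, ⟨(hc 0).2, (hc 1).2, (hc 2).2, (hc 3).2⟩, ?_⟩
  obtain ⟨i, hi, j, hj, hij⟩ := h.two
  fin_cases i <;> fin_cases j <;> simp_all

end Branches

variable {G : SimpleGraph V} {q : CliquePair V} {Z : Set V} {T : V → Finset V}

/-- Weights 1, 1 force a path. -/
theorem forces_edge (hq : Derives (.start G) q) (hJ : Joined G q Z T) {x y : V} (hxy : x ≠ y)
    (hx : 1 ≤ (T x).card) (hy : 1 ≤ (T y).card) : Linkage G Z {s(x, y)} := by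
  refine forced_of_branches (u := ![x, y]) ![1, 1] (by decide) (by decide)
    (fun Z u => Linkage G Z {s(u 0, u 1)}) ?_ hq hJ (injective_vec₂ hxy)
    (by simp [Fin.forall_fin_succ, hx, hy])
  intro q₀ hq₀ _ Z u w S Z' T' hB
  obtain ⟨h0, h1⟩ := mem_of_two₂ hB.two
  exact hB.suppress₀ (.empty G Z') (.inr (mem_star h0)) (.inr (mem_star h1)) (by simp)

/-- Weights 1, 1, 1 force a claw. -/
theorem forces_claw (hq : Derives (.start G) q) (hJ : Joined G q Z T) {x y z : V} (hxy : x ≠ y)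
    (hxz : x ≠ z) (hyz : y ≠ z) (hx : 1 ≤ (T x).card) (hy : 1 ≤ (T y).card)
    (hz : 1 ≤ (T z).card) : ∃ b ∉ Z, Linkage G ({b} ∪ Z) {s(b, x), s(b, y), s(b, z)} := by
  refine forced_of_branches (u := ![x, y, z]) ![1, 1, 1] (by decide) (by decide)
    (fun Z u => ∃ b ∉ Z, Linkage G ({b} ∪ Z) {s(b, u 0), s(b, u 1), s(b, u 2)}) ?_ hq hJ
    (injective_vec₃ hxy hxz hyz) (by simp [Fin.forall_fin_succ, hx, hy, hz])
  intro q₀ hq₀ _ Z u w S Z' T' hB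
  obtain ⟨-, ⟨n0, n1, n2⟩, ⟨m0, m1, m2⟩, ⟨⟨s0, s1, s2⟩, -, -, -⟩ | ⟨⟨s0, s1⟩, c0, c1, c2⟩ |
    ⟨⟨s0, s2⟩, c0, c1, c2⟩ | ⟨⟨s1, s2⟩, c0, c1, c2⟩⟩ := hB.cases₃
  · exact ⟨w, hB.notMem, hB.keep₀ (.empty G Z') (by simp [Set.insert_subset_iff, mem_star, *])⟩
  · exact ⟨w, hB.notMem, hB.keep₀ (forces_edge hq₀ hB.joined n2 (by omega) (by omega))
      (by simp [Set.insert_subset_iff, mem_star, *])⟩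
  · exact ⟨w, hB.notMem, hB.keep₀ (forces_edge hq₀ hB.joined n1 (by omega) (by omega))
      (by simp [Set.insert_subset_iff, mem_star, *])⟩
  · exact ⟨w, hB.notMem, hB.keep₀ (forces_edge hq₀ hB.joined n0 (by omega) (by omega))
      (by simp [Set.insert_subset_iff, mem_star, *])⟩

/-- Weights 1, 2, 2 force a path on the three terminals whose middle vertex has weight 2. -/
theorem forces_path (hq : Derives (.start G) q) (hJ : Joined G q Z T) {x y z : V} (hxy : x ≠ y)
    (hxz : x ≠ z) (hyz : y ≠ z) (hx : 1 ≤ (T x).card) (hy : 2 ≤ (T y).card)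
    (hz : 2 ≤ (T z).card) : Linkage G Z {s(x, y), s(y, z)} := by
  refine forced_of_branches (u := ![x, y, z]) ![1, 2, 2] (by decide) (by decide)
    (fun Z u => Linkage G Z {s(u 0, u 1), s(u 1, u 2)}) ?_ hq hJ
    (injective_vec₃ hxy hxz hyz) (by simp [Fin.forall_fin_succ, hx, hy, hz])
  intro q₀ hq₀ ih Z u w S Z' T' hB
  obtain ⟨⟨h01, h02, h12⟩, ⟨n0, n1, n2⟩, ⟨m0, m1, m2⟩, ⟨⟨s0, s1, s2⟩, c0, c1, c2⟩ |
    ⟨⟨s0, s1⟩, c0, c1, c2⟩ | ⟨⟨s0, s2⟩, c0, c1, c2⟩ | ⟨⟨s1, s2⟩, c0, c1, c2⟩⟩ := hB.cases₃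
  · exact hB.suppress₀ (x := u 0) (y := u 1) (forces_edge hq₀ hB.joined h12 (by omega) (by omega))
      (by simp [mem_star, *]) (by simp [mem_star, *]) (by simp [Set.insert_subset_iff, *])
  · exact hB.suppress₀ (x := u 0) (y := u 1) (forces_edge hq₀ hB.joined h12 (by omega) (by omega))
      (by simp [mem_star, *]) (by simp [mem_star, *]) (by simp [Set.insert_subset_iff, *])
  · -- the same configuration for `u 2`, `u 1`, `w`
    have hL : Linkage G Z' {s(u 2, u 1), s(u 1, w)} := ih Z' T' ![u 2, u 1, w] hB.joined
      (injective_vec₃ h12.symm n2.symm n1.symm)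
      (by simp only [Fin.forall_fin_succ, IsEmpty.forall_iff, and_true]; dsimp; omega)
    exact hB.suppress₀ (x := u 0) (y := u 1) hL (by simp [mem_star, *]) (by simp [*])
      (by simp [Set.insert_subset_iff, *])
  · exact hB.suppress₀ (x := u 1) (y := u 2) (forces_edge hq₀ hB.joined h01 (by omega) (by omega))
      (by simp [mem_star, *]) (by simp [mem_star, *]) (by simp [Set.insert_subset_iff, *])

/-- Weights 1, 2, 2 force a claw and a further path between the terminals of weight 2. -/
theorem forces_claw_edge (hq : Derives (.start G) q) (hJ : Joined G q Z T) {x y z : V} (hxy : x ≠ y)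
    (hxz : x ≠ z) (hyz : y ≠ z) (hx : 1 ≤ (T x).card) (hy : 2 ≤ (T y).card)
    (hz : 2 ≤ (T z).card) :
    ∃ b ∉ Z, Linkage G ({b} ∪ Z) {s(y, z), s(b, x), s(b, y), s(b, z)} := by
  refine forced_of_branches (u := ![x, y, z]) ![1, 2, 2] (by decide) (by decide)
    (fun Z u => ∃ b ∉ Z, Linkage G ({b} ∪ Z) {s(u 1, u 2), s(b, u 0), s(b, u 1), s(b, u 2)}) ?_
    hq hJ (injective_vec₃ hxy hxz hyz) (by simp [Fin.forall_fin_succ, hx, hy, hz])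
  intro q₀ hq₀ _ Z u w S Z' T' hB
  obtain ⟨⟨h01, h02, h12⟩, ⟨n0, n1, n2⟩, ⟨m0, m1, m2⟩, ⟨⟨s0, s1, s2⟩, c0, c1, c2⟩ |
    ⟨⟨s0, s1⟩, c0, c1, c2⟩ | ⟨⟨s0, s2⟩, c0, c1, c2⟩ | ⟨⟨s1, s2⟩, c0, c1, c2⟩⟩ := hB.cases₃
  · exact ⟨w, hB.notMem, hB.keep₀ (forces_edge hq₀ hB.joined h12 (by omega) (by omega))
      (by simp [Set.insert_subset_iff, mem_star, *])⟩
  · exact ⟨w, hB.notMem, hB.keep₀ (forces_path hq₀ hB.joined h12 n1.symm n2.symm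
      (by omega) (by omega) (by omega)) (by simp [Set.insert_subset_iff, mem_star, *])⟩
  · exact ⟨w, hB.notMem, hB.keep₀ (forces_path hq₀ hB.joined h12.symm n2.symm n1.symm
      (by omega) (by omega) (by omega)) (by simp [Set.insert_subset_iff, mem_star, *])⟩
  · obtain ⟨b, hb, hL⟩ := forces_claw hq₀ hB.joined h01 h02 h12 (by omega) (by omega) (by omega)
    have hwb := hB.ne_new hb
    exact ⟨b, hB.notMem_of_new hb, hB.suppress (x := u 1) (y := u 2) (by simpa using hb) hL
      (by simp [mem_star, *]) (by simp [mem_star, *]) (by simp [Set.insert_subset_iff, *])⟩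

/-- Weights 1, 2, 3, 3 force a star on the four terminals whose centre is a vertex of weight 3. -/
theorem forces_star (hq : Derives (.start G) q) (hJ : Joined G q Z T) {x y z c : V} (hxy : x ≠ y)
    (hxz : x ≠ z) (hxc : x ≠ c) (hyz : y ≠ z) (hyc : y ≠ c) (hzc : z ≠ c) (hx : 1 ≤ (T x).card)
    (hy : 2 ≤ (T y).card) (hz : 3 ≤ (T z).card) (hc : 3 ≤ (T c).card) :
    Linkage G Z {s(c, x), s(c, y), s(c, z)} := by
  refine forced_of_branches (u := ![x, y, z, c]) ![1, 2, 3, 3] (by decide) (by decide)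
    (fun Z u => Linkage G Z {s(u 3, u 0), s(u 3, u 1), s(u 3, u 2)}) ?_
    hq hJ (injective_vec₄ hxy hxz hyz hxc hyc hzc) (by simp [Fin.forall_fin_succ, hx, hy, hz, hc])
  intro q₀ hq₀ ih Z u w S Z' T' hB
  replace ih : ∀ x y z c, x ≠ y → x ≠ z → x ≠ c → y ≠ z → y ≠ c → z ≠ c → 1 ≤ (T' x).card →
      2 ≤ (T' y).card → 3 ≤ (T' z).card → 3 ≤ (T' c).card →
      Linkage G Z' {s(c, x), s(c, y), s(c, z)} := fun x y z c h1 h2 h3 h4 h5 h6 hx hy hz hc =>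
    ih Z' T' ![x, y, z, c] hB.joined (injective_vec₄ h1 h2 h4 h3 h5 h6)
      (by simp [Fin.forall_fin_succ, hx, hy, hz, hc])
  obtain ⟨⟨h01, h02, h03, h12, h13, h23⟩, ⟨n0, n1, n2, n3⟩, ⟨m0, m1, m2, m3⟩, ⟨c0, c1, c2, c3⟩,
    ⟨s0, s1, s2, s3⟩, hS⟩ := hB.cases₄
  -- If `w` is linked to the centre and to a leaf, this gives the path from the centre to the first
  -- such leaf; otherwise `w` replaces a leaf to which it is linked.
  rcases s3 with s3 | ⟨s3, d3⟩
  · rcases s0 with s0 | ⟨s0, d0⟩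
    · exact hB.suppress₀ (x := u 3) (y := u 0) (forces_path hq₀ hB.joined h13 h12 h23.symm
        (by omega) (by omega) (by omega)) (by simp [mem_star, *]) (by simp [mem_star, *])
        (by simp [Set.insert_subset_iff, *])
    rcases s1 with s1 | ⟨s1, d1⟩
    · exact hB.suppress₀ (x := u 3) (y := u 1) (forces_path hq₀ hB.joined h03 h02 h23.symm
        (by omega) (by omega) (by omega)) (by simp [mem_star, *]) (by simp [mem_star, *])
        (by simp [Set.insert_subset_iff, *])
    · have s2 : 2 ∈ S := by simpa [*] using hS
      exact hB.suppress₀ (x := u 3) (y := u 2) (forces_path hq₀ hB.joined h03 h01 h13.symm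
        (by omega) (by omega) (by omega)) (by simp [mem_star, *]) (by simp [mem_star, *])
        (by simp [Set.insert_subset_iff, *])
  · rcases s0 with s0 | ⟨s0, d0⟩
    · rcases s2 with s2 | ⟨s2, d2⟩
      · have hL := ih (u 1) (u 2) w (u 3) h12 n1.symm h13 n2.symm h23 n3 (by omega) (by omega)
          (by omega) (by omega)
        exact hB.suppress₀ (x := u 3) (y := u 0) hL (by simp [*]) (by simp [mem_star, *])
          (by simp [Set.insert_subset_iff, *])
      · have hL := ih (u 1) w (u 2) (u 3) n1.symm h12 h13 n2 n3 h23 (by omega) (by omega)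
          (by omega) (by omega)
        exact hB.suppress₀ (x := u 3) (y := u 0) hL (by simp [*]) (by simp [mem_star, *])
          (by simp [Set.insert_subset_iff, *])
    · have s12 : 1 ∈ S ∧ 2 ∈ S := by simpa [*] using hS
      have s1 := s12.1
      have hL := ih (u 0) (u 2) w (u 3) h02 n0.symm h03 n2.symm h23 n3 (by omega) (by omega)
        (by omega) (by omega)
      exact hB.suppress₀ (x := u 3) (y := u 1) hL (by simp [*]) (by simp [mem_star, *])
        (by simp [Set.insert_subset_iff, *])

/-- Weights 2, 3, 3 force a claw and two further paths from a terminal of weight 3 to the other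
terminals. -/
theorem forces_claw_path (hq : Derives (.start G) q) (hJ : Joined G q Z T) {x y z : V} (hxy : x ≠ y)
    (hxz : x ≠ z) (hyz : y ≠ z) (hx : 2 ≤ (T x).card) (hy : 3 ≤ (T y).card)
    (hz : 3 ≤ (T z).card) :
    ∃ b ∉ Z, Linkage G ({b} ∪ Z) {s(y, x), s(y, z), s(b, x), s(b, y), s(b, z)} := by
  refine forced_of_branches (u := ![x, y, z]) ![2, 3, 3] (by decide) (by decide)
    (fun Z u => ∃ b ∉ Z, Linkage G ({b} ∪ Z)
      {s(u 1, u 0), s(u 1, u 2), s(b, u 0), s(b, u 1), s(b, u 2)}) ?_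
    hq hJ (injective_vec₃ hxy hxz hyz) (by simp [Fin.forall_fin_succ, hx, hy, hz])
  intro q₀ hq₀ _ Z u w S Z' T' hB
  obtain ⟨⟨h01, h02, h12⟩, ⟨n0, n1, n2⟩, ⟨m0, m1, m2⟩, ⟨⟨s0, s1, s2⟩, c0, c1, c2⟩ |
    ⟨⟨s0, s1⟩, c0, c1, c2⟩ | ⟨⟨s0, s2⟩, c0, c1, c2⟩ | ⟨⟨s1, s2⟩, c0, c1, c2⟩⟩ := hB.cases₃
  · exact ⟨w, hB.notMem, hB.keep₀ (forces_path hq₀ hB.joined h01 h02 h12 (by omega) (by omega)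
      (by omega)) (by simp [Set.insert_subset_iff, mem_star, *])⟩
  · obtain ⟨b, hb, hL⟩ := forces_claw_edge hq₀ hB.joined h01 h02 h12 (by omega) (by omega)
      (by omega)
    have hwb := hB.ne_new hb
    exact ⟨b, hB.notMem_of_new hb, hB.suppress (x := u 1) (y := u 0) (by simpa using hb) hL
      (by simp [mem_star, *]) (by simp [mem_star, *]) (by simp [Set.insert_subset_iff, *])⟩
  · exact ⟨w, hB.notMem, hB.keep₀ (forces_star hq₀ hB.joined h02 n0.symm h01 n2.symm h12.symm n1
      (by omega) (by omega) (by omega) (by omega)) (by simp [Set.insert_subset_iff, mem_star, *])⟩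
  · obtain ⟨b, hb, hL⟩ := forces_claw_edge hq₀ hB.joined h02.symm h12.symm h01 (by omega) (by omega)
      (by omega)
    have hwb := hB.ne_new hb
    exact ⟨b, hB.notMem_of_new hb, hB.suppress (x := u 1) (y := u 2) (by simpa using hb) hL
      (by simp [mem_star, *]) (by simp [mem_star, *]) (by simp [Set.insert_subset_iff, *])⟩

/-! ### The configurations of the theorem -/

/-- The configuration `C9`. -/
theorem forces_C9 (hq : Derives (.start G) q) (hJ : Joined G q Z T) {x y z t : V} (hxy : x ≠ y)
    (hxz : x ≠ z) (hxt : x ≠ t) (hyz : y ≠ z) (hyt : y ≠ t) (hzt : z ≠ t) (hx : 1 ≤ (T x).card)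
    (hy : 1 ≤ (T y).card) (hz : 2 ≤ (T z).card) (ht : 2 ≤ (T t).card) :
    ∃ b ∉ Z, Linkage G ({b} ∪ Z) {s(x, b), s(y, b), s(z, b), s(t, b)} ∨
      Linkage G ({b} ∪ Z) {s(x, b), s(y, b), s(z, t), s(z, b)} := by
  refine forced_of_branches (u := ![x, y, z, t]) ![1, 1, 2, 2] (by decide) (by decide)
    (fun Z u => ∃ b ∉ Z, Linkage G ({b} ∪ Z) {s(u 0, b), s(u 1, b), s(u 2, b), s(u 3, b)} ∨
      Linkage G ({b} ∪ Z) {s(u 0, b), s(u 1, b), s(u 2, u 3), s(u 2, b)}) ?_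
    hq hJ (injective_vec₄ hxy hxz hyz hxt hyt hzt) (by simp [Fin.forall_fin_succ, hx, hy, hz, ht])
  intro q₀ hq₀ _ Z u w S Z' T' hB
  obtain ⟨⟨h01, h02, h03, h12, h13, h23⟩, ⟨n0, n1, n2, n3⟩, ⟨m0, m1, m2, m3⟩, ⟨c0, c1, c2, c3⟩,
    ⟨s0, s1, s2, s3⟩, hS⟩ := hB.cases₄
  rcases s0 with s0 | ⟨s0, d0⟩ <;> rcases s1 with s1 | ⟨s1, d1⟩ <;>
    rcases s2 with s2 | ⟨s2, d2⟩ <;> rcases s3 with s3 | ⟨s3, d3⟩ <;>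
    first
    | (exfalso; simp [*] at hS; done)
    | skip
  -- Three or more links to `w` give a star with centre `w`. So does `forces_path` if `w` is linked to
  -- a terminal of weight 1 and one of weight 2; the other two cases give the second graph.
  · exact ⟨w, hB.notMem, .inl (hB.keep₀ (.empty G Z')
      (by simp [Set.insert_subset_iff, mem_star_swap, *]))⟩
  · exact ⟨w, hB.notMem, .inl (hB.keep₀ (forces_edge hq₀ hB.joined n3 (by omega) (by omega))
      (by simp [Set.insert_subset_iff, mem_star_swap, *]))⟩
  · exact ⟨w, hB.notMem, .inl (hB.keep₀ (forces_edge hq₀ hB.joined n2 (by omega) (by omega))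
      (by simp [Set.insert_subset_iff, mem_star_swap, *]))⟩
  · exact ⟨w, hB.notMem, .inr (hB.keep₀ (forces_path hq₀ hB.joined n2 n3 h23
      (by omega) (by omega) (by omega)) (by simp [Set.insert_subset_iff, mem_star_swap, *]))⟩
  · exact ⟨w, hB.notMem, .inl (hB.keep₀ (forces_edge hq₀ hB.joined n1 (by omega) (by omega))
      (by simp [Set.insert_subset_iff, mem_star_swap, *]))⟩
  · exact ⟨w, hB.notMem, .inl (hB.keep₀ (forces_path hq₀ hB.joined n1.symm h13 n3
      (by omega) (by omega) (by omega)) (by simp [Set.insert_subset_iff, mem_star_swap, *]))⟩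
  · exact ⟨w, hB.notMem, .inl (hB.keep₀ (forces_path hq₀ hB.joined n1.symm h12 n2
      (by omega) (by omega) (by omega)) (by simp [Set.insert_subset_iff, mem_star_swap, *]))⟩
  · exact ⟨w, hB.notMem, .inl (hB.keep₀ (forces_edge hq₀ hB.joined n0 (by omega) (by omega))
      (by simp [Set.insert_subset_iff, mem_star_swap, *]))⟩
  · exact ⟨w, hB.notMem, .inl (hB.keep₀ (forces_path hq₀ hB.joined n0.symm h03 n3
      (by omega) (by omega) (by omega)) (by simp [Set.insert_subset_iff, mem_star_swap, *]))⟩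
  · exact ⟨w, hB.notMem, .inl (hB.keep₀ (forces_path hq₀ hB.joined n0.symm h02 n2
      (by omega) (by omega) (by omega)) (by simp [Set.insert_subset_iff, mem_star_swap, *]))⟩
  · obtain ⟨b, hb, hL⟩ := forces_claw hq₀ hB.joined h01 h02 h12 (by omega) (by omega) (by omega)
    have hwb := hB.ne_new hb
    exact ⟨b, hB.notMem_of_new hb, .inr (hB.suppress (x := u 2) (y := u 3) (by simpa using hb) hL
      (by simp [mem_star, *]) (by simp [mem_star, *]) (by simp [Set.insert_subset_iff, *]))⟩

/-- The configuration `C7`. The new vertex `w` is one of the two vertices `b` and `c`, and the other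
one comes from a claw for `w` and two or three of the terminals. -/
theorem forces_C7 (hq : Derives (.start G) q) (hJ : Joined G q Z T) {x y z : V} (hxy : x ≠ y)
    (hxz : x ≠ z) (hyz : y ≠ z) (hx : 2 ≤ (T x).card) (hy : 2 ≤ (T y).card)
    (hz : 2 ≤ (T z).card) :
    ∃ b c, b ∉ Z ∧ c ∉ Z ∧ b ≠ c ∧
      Linkage G ({b, c} ∪ Z) {s(x, b), s(y, b), s(z, b), s(x, c), s(y, c), s(b, c)} := by
  refine forced_of_branches (u := ![x, y, z]) ![2, 2, 2] (by decide) (by decide)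
    (fun Z u => ∃ b c, b ∉ Z ∧ c ∉ Z ∧ b ≠ c ∧ Linkage G ({b, c} ∪ Z)
      {s(u 0, b), s(u 1, b), s(u 2, b), s(u 0, c), s(u 1, c), s(b, c)}) ?_
    hq hJ (injective_vec₃ hxy hxz hyz) (by simp [Fin.forall_fin_succ, hx, hy, hz])
  intro q₀ hq₀ _ Z u w S Z' T' hB
  obtain ⟨⟨h01, h02, h12⟩, ⟨n0, n1, n2⟩, ⟨m0, m1, m2⟩, ⟨⟨s0, s1, s2⟩, c0, c1, c2⟩ |
    ⟨⟨s0, s1⟩, c0, c1, c2⟩ | ⟨⟨s0, s2⟩, c0, c1, c2⟩ | ⟨⟨s1, s2⟩, c0, c1, c2⟩⟩ := hB.cases₃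
  · obtain ⟨c, hc, hL⟩ := forces_claw hq₀ hB.joined h01 n0.symm n1.symm (by omega) (by omega)
      (by omega)
    exact ⟨w, c, hB.notMem, hB.notMem_of_new hc, hB.ne_new hc, hB.keep (by simpa using hc) hL
      (by simp [Set.insert_subset_iff, mem_star_swap, *])⟩
  · obtain ⟨c, hc, hL | hL⟩ := forces_C9 hq₀ hB.joined h01 n0.symm h02 n1.symm h12 n2 (by omega)
      (by omega) (by omega) (by omega)
    · refine ⟨c, w, hB.notMem_of_new hc, hB.notMem, (hB.ne_new hc).symm, ?_⟩
      rw [Set.pair_comm]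
      exact hB.keep (by simpa using hc) hL (by simp [Set.insert_subset_iff, mem_star_swap, *])
    · exact ⟨w, c, hB.notMem, hB.notMem_of_new hc, hB.ne_new hc, hB.keep (by simpa using hc) hL
        (by simp [Set.insert_subset_iff, mem_star_swap, *])⟩
  · obtain ⟨c, hc, hL⟩ := forces_claw_edge hq₀ hB.joined h01 n0.symm n1.symm (by omega) (by omega)
      (by omega)
    exact ⟨w, c, hB.notMem, hB.notMem_of_new hc, hB.ne_new hc, hB.keep (by simpa using hc) hL
      (by simp [Set.insert_subset_iff, mem_star_swap, *])⟩
  · obtain ⟨c, hc, hL⟩ := forces_claw_edge hq₀ hB.joined h01.symm n1.symm n0.symm (by omega)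
      (by omega) (by omega)
    exact ⟨w, c, hB.notMem, hB.notMem_of_new hc, hB.ne_new hc, hB.keep (by simpa using hc) hL
      (by simp [Set.insert_subset_iff, mem_star_swap, *])⟩

/-- The configuration `C8`. If `w` is linked to the two terminals of weight 3, it provides the path
between them or the vertex `b`, and `C7` gives the rest. -/
theorem forces_C8 (hq : Derives (.start G) q) (hJ : Joined G q Z T) {x y z : V} (hxy : x ≠ y)
    (hxz : x ≠ z) (hyz : y ≠ z) (hx : 3 ≤ (T x).card) (hy : 3 ≤ (T y).card)
    (hz : 2 ≤ (T z).card) :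
    ∃ b c, b ∉ Z ∧ c ∉ Z ∧ b ≠ c ∧ Linkage G ({b, c} ∪ Z)
      {s(x, y), s(x, b), s(y, b), s(z, b), s(x, c), s(y, c), s(b, c)} := by
  refine forced_of_branches (u := ![x, y, z]) ![3, 3, 2] (by decide) (by decide)
    (fun Z u => ∃ b c, b ∉ Z ∧ c ∉ Z ∧ b ≠ c ∧ Linkage G ({b, c} ∪ Z)
      {s(u 0, u 1), s(u 0, b), s(u 1, b), s(u 2, b), s(u 0, c), s(u 1, c), s(b, c)}) ?_
    hq hJ (injective_vec₃ hxy hxz hyz) (by simp [Fin.forall_fin_succ, hx, hy, hz])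
  intro q₀ hq₀ _ Z u w S Z' T' hB
  obtain ⟨⟨h01, h02, h12⟩, ⟨n0, n1, n2⟩, ⟨m0, m1, m2⟩, ⟨⟨s0, s1, s2⟩, c0, c1, c2⟩ |
    ⟨⟨s0, s1⟩, c0, c1, c2⟩ | ⟨⟨s0, s2⟩, c0, c1, c2⟩ | ⟨⟨s1, s2⟩, c0, c1, c2⟩⟩ := hB.cases₃
  · -- the second new vertex becomes an inner vertex of the path from `u 0` to `u 1`
    obtain ⟨b, c, hb, hc, hbc, hL⟩ := forces_C7 hq₀ hB.joined h01 n0.symm n1.symm (by omega)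
      (by omega) (by omega)
    have hwc := hB.ne_new hc
    have hcZ := hB.notMem_of_new hc
    have hcu : ∀ i, c ≠ u i := fun i h => hcZ (h ▸ hB.mem i)
    have hL' := (hB.keep (by simp [hb, hc]) hL (subset_refl _)).mono
      (Z' := insert c ({w, b} ∪ Z)) (fun v => by simp; tauto) (subset_refl _)
    exact ⟨w, b, hB.notMem, hB.notMem_of_new hb, hB.ne_new hb,
      hL'.suppress (x := u 0) (y := u 1) (by simp [hwc.symm, hbc.symm, hcZ]) (by simp) (by simp)
      (by simp [Set.insert_subset_iff, mem_star_swap, hbc.symm, hwc.symm, *])⟩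
  · obtain ⟨b, c, hb, hc, hbc, hL⟩ := forces_C7 hq₀ hB.joined h01 h02 h12 (by omega)
      (by omega) (by omega)
    have hwb := hB.ne_new hb
    have hwc := hB.ne_new hc
    exact ⟨b, c, hB.notMem_of_new hb, hB.notMem_of_new hc, hbc,
      hB.suppress (x := u 0) (y := u 1) (by simp [hb, hc]) hL (by simp [mem_star, *])
        (by simp [mem_star, *]) (by simp [Set.insert_subset_iff, *])⟩
  · obtain ⟨c, hc, hL⟩ := forces_claw_path hq₀ hB.joined h01 n0.symm n1.symm (by omega) (by omega)
      (by omega)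
    exact ⟨w, c, hB.notMem, hB.notMem_of_new hc, hB.ne_new hc, hB.keep (by simpa using hc) hL
      (by simp [Set.insert_subset_iff, mem_star_swap, *])⟩
  · obtain ⟨c, hc, hL⟩ := forces_claw_path hq₀ hB.joined h01.symm n1.symm n0.symm (by omega)
      (by omega) (by omega)
    exact ⟨w, c, hB.notMem, hB.notMem_of_new hc, hB.ne_new hc, hB.keep (by simpa using hc) hL
      (by simp [Set.insert_subset_iff, mem_star_swap, *])⟩

/-- The edges of the first graph of `C6`, for the terminals `x, y, z`. The other graphs of `C6`
arise from cyclic permutations of the terminals. -/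
def triadEdges (x y z b c d : V) : Set (Sym2 V) :=
  {s(x, b), s(y, b), s(z, b), s(x, c), s(y, c), s(b, c), s(x, d), s(b, d), s(c, d)}

/-- The configuration `C6`. The new vertex `w` is the vertex `b` that is joined to all terminals. -/
theorem forces_C6 (hq : Derives (.start G) q) (hJ : Joined G q Z T) {x y z : V} (hxy : x ≠ y)
    (hxz : x ≠ z) (hyz : y ≠ z) (hx : 3 ≤ (T x).card) (hy : 3 ≤ (T y).card)
    (hz : 3 ≤ (T z).card) :
    ∃ b c d, (b ∉ Z ∧ c ∉ Z ∧ d ∉ Z) ∧ (b ≠ c ∧ b ≠ d ∧ c ≠ d) ∧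
      (Linkage G ({b, c, d} ∪ Z) (triadEdges x y z b c d) ∨
        Linkage G ({b, c, d} ∪ Z) (triadEdges z x y b c d) ∨
        Linkage G ({b, c, d} ∪ Z) (triadEdges y z x b c d)) := by
  refine forced_of_branches (u := ![x, y, z]) ![3, 3, 3] (by decide) (by decide)
    (fun Z u => ∃ b c d, (b ∉ Z ∧ c ∉ Z ∧ d ∉ Z) ∧ (b ≠ c ∧ b ≠ d ∧ c ≠ d) ∧
      (Linkage G ({b, c, d} ∪ Z) (triadEdges (u 0) (u 1) (u 2) b c d) ∨
        Linkage G ({b, c, d} ∪ Z) (triadEdges (u 2) (u 0) (u 1) b c d) ∨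
        Linkage G ({b, c, d} ∪ Z) (triadEdges (u 1) (u 2) (u 0) b c d))) ?_
    hq hJ (injective_vec₃ hxy hxz hyz) (by simp [Fin.forall_fin_succ, hx, hy, hz])
  intro q₀ hq₀ _ Z u w S Z' T' hB
  have key : ∀ {b c x y z E}, b ∉ Z' → c ∉ Z' → b ≠ c → Linkage G ({b, c} ∪ Z') E →
      triadEdges x y z w b c ⊆ E ∪ star w u S →
      (w ∉ Z ∧ b ∉ Z ∧ c ∉ Z) ∧ (w ≠ b ∧ w ≠ c ∧ b ≠ c) ∧
        Linkage G ({w, b, c} ∪ Z) (triadEdges x y z w b c) :=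
    fun hb hc hbc hL hE => ⟨⟨hB.notMem, hB.notMem_of_new hb, hB.notMem_of_new hc⟩,
      ⟨hB.ne_new hb, hB.ne_new hc, hbc⟩, hB.keep (by simp [hb, hc]) hL hE⟩
  obtain ⟨⟨h01, h02, h12⟩, ⟨n0, n1, n2⟩, ⟨m0, m1, m2⟩, ⟨⟨s0, s1, s2⟩, c0, c1, c2⟩ |
    ⟨⟨s0, s1⟩, c0, c1, c2⟩ | ⟨⟨s0, s2⟩, c0, c1, c2⟩ | ⟨⟨s1, s2⟩, c0, c1, c2⟩⟩ := hB.cases₃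
  · obtain ⟨b, c, hb, hc, hbc, hL⟩ := forces_C7 hq₀ hB.joined n0 n1 h01 (by omega) (by omega)
      (by omega)
    obtain ⟨hZ, hd, hL⟩ := key (x := u 0) (y := u 1) (z := u 2) hb hc hbc hL
      (by simp [triadEdges, Set.insert_subset_iff, mem_star_swap, *])
    exact ⟨w, b, c, hZ, hd, .inl hL⟩
  · obtain ⟨b, c, hb, hc, hbc, hL⟩ := forces_C8 hq₀ hB.joined n2 n0 h02.symm (by omega) (by omega)
      (by omega)
    obtain ⟨hZ, hd, hL⟩ := key (x := u 2) (y := u 0) (z := u 1) hb hc hbc hL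
      (by simp [triadEdges, Set.insert_subset_iff, mem_star_swap, *])
    exact ⟨w, b, c, hZ, hd, .inr (.inl hL)⟩
  · obtain ⟨b, c, hb, hc, hbc, hL⟩ := forces_C8 hq₀ hB.joined n1 n2 h12 (by omega) (by omega)
      (by omega)
    obtain ⟨hZ, hd, hL⟩ := key (x := u 1) (y := u 2) (z := u 0) hb hc hbc hL
      (by simp [triadEdges, Set.insert_subset_iff, mem_star_swap, *])
    exact ⟨w, b, c, hZ, hd, .inr (.inr hL)⟩
  · obtain ⟨b, c, hb, hc, hbc, hL⟩ := forces_C8 hq₀ hB.joined n0 n1 h01 (by omega) (by omega)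
      (by omega)
    obtain ⟨hZ, hd, hL⟩ := key (x := u 0) (y := u 1) (z := u 2) hb hc hbc hL
      (by simp [triadEdges, Set.insert_subset_iff, mem_star_swap, *])
    exact ⟨w, b, c, hZ, hd, .inl hL⟩

/-- The configuration `C5`. Its graphs arise from those of `C6` by joining one of the three
terminals to the other two. -/
theorem forces_C5 (hq : Derives (.start G) q) (hJ : Joined G q Z T) {x y : V} (hxy : x ≠ y)
    (hx : 4 ≤ (T x).card) (hy : 4 ≤ (T y).card) :
    ∃ z b c d, (z ∉ Z ∧ b ∉ Z ∧ c ∉ Z ∧ d ∉ Z) ∧ (z ≠ b ∧ z ≠ c ∧ z ≠ d ∧ b ≠ c ∧ b ≠ d ∧ c ≠ d) ∧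
      (Linkage G ({z, b, c, d} ∪ Z) ({s(x, z), s(y, z)} ∪ triadEdges x y z b c d) ∨
        Linkage G ({z, b, c, d} ∪ Z) ({s(x, z), s(y, z)} ∪ triadEdges z x y b c d) ∨
        Linkage G ({z, b, c, d} ∪ Z) ({s(x, z), s(y, z)} ∪ triadEdges y z x b c d)) := by
  refine forced_of_branches (u := ![x, y]) ![4, 4] (by decide) (by decide)
    (fun Z u => ∃ z b c d, (z ∉ Z ∧ b ∉ Z ∧ c ∉ Z ∧ d ∉ Z) ∧
      (z ≠ b ∧ z ≠ c ∧ z ≠ d ∧ b ≠ c ∧ b ≠ d ∧ c ≠ d) ∧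
      (Linkage G ({z, b, c, d} ∪ Z) ({s(u 0, z), s(u 1, z)} ∪ triadEdges (u 0) (u 1) z b c d) ∨
        Linkage G ({z, b, c, d} ∪ Z) ({s(u 0, z), s(u 1, z)} ∪ triadEdges z (u 0) (u 1) b c d) ∨
        Linkage G ({z, b, c, d} ∪ Z)
          ({s(u 0, z), s(u 1, z)} ∪ triadEdges (u 1) z (u 0) b c d))) ?_
    hq hJ (injective_vec₂ hxy) (by simp [Fin.forall_fin_succ, hx, hy])
  intro q₀ hq₀ _ Z u w S Z' T' hB
  obtain ⟨s0, s1⟩ := mem_of_two₂ hB.two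
  have c0 : 4 ≤ _ := hB.card 0
  have c1 : 4 ≤ _ := hB.card 1
  have m0 := hB.card_le (u 0)
  rw [if_pos s0] at c0
  rw [if_pos s1] at c1
  obtain ⟨b, c, d, ⟨hb, hc, hd⟩, ⟨hbc, hbd, hcd⟩, hL⟩ := forces_C6 hq₀ hB.joined
    (hB.inj.ne (by decide : (0 : Fin 2) ≠ 1)) (hB.ne 0).symm (hB.ne 1).symm (by omega) (by omega)
    (by omega)
  have key : ∀ {E}, Linkage G ({b, c, d} ∪ Z') E →
      Linkage G ({w, b, c, d} ∪ Z) ({s(u 0, w), s(u 1, w)} ∪ E) := fun hL =>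
    hB.keep (by simp [hb, hc, hd]) hL
      (by rw [Set.union_comm]; gcongr; simp [Set.insert_subset_iff, mem_star_swap, *])
  refine ⟨w, b, c, d, ⟨hB.notMem, hB.notMem_of_new hb, hB.notMem_of_new hc, hB.notMem_of_new hd⟩,
    ⟨hB.ne_new hb, hB.ne_new hc, hB.ne_new hd, hbc, hbd, hcd⟩, ?_⟩
  exact hL.imp key (Or.imp key key)

/-! ### From linkages to the graphs of the configurations -/

theorem Linkage.isSubdivisionAt_sumElim {t s : ℕ} {E : Set (Sym2 (Fin t ⊕ Fin s))} {u : Fin t → V}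
    {v : Fin s → V} {F : Set (Sym2 V)} (hL : Linkage G (Set.range v ∪ Set.range u) F)
    (hu : Function.Injective u) (hv : Function.Injective v) (huv : ∀ j, v j ∉ Set.range u)
    (hE : ∀ e ∈ E, e.map (Sum.elim u v) ∈ F) : IsSubdivisionAt G (ofEdges E) (Sum.elim u v) := by
  refine hL.isSubdivisionAt (hu.sumElim hv fun i j h => huv j ⟨i, h⟩) ?_ fun a b hab => ?_
  · rintro (i | j)
    exacts [.inr ⟨i, rfl⟩, .inl ⟨j, rfl⟩]
  · exact hE _ ((SimpleGraph.fromEdgeSet_adj _).1 hab).1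

theorem range_vec₁ (x : V) : Set.range ![x] = {x} := by
  ext; simp [eq_comm]

theorem range_vec₂ (x y : V) : Set.range ![x, y] = {x, y} := by
  ext; simp [eq_comm, or_comm]

theorem range_vec₃ (x y z : V) : Set.range ![x, y, z] = {x, y, z} := by
  ext; simp [eq_comm, or_comm, or_left_comm]

theorem range_vec₄ (x y z t : V) : Set.range ![x, y, z, t] = {x, y, z, t} := by
  ext; simp [eq_comm, or_comm, or_left_comm]

theorem unavoidable_C9 : Config.Unavoidable.{u} C9 := by
  intro V _ G q hq u hu
  have hui := hu.1
  obtain ⟨T, hJ, hT⟩ := hu.joined hq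
  have hne : ∀ i j, i ≠ j → u i ≠ u j := fun i j => hui.ne
  obtain ⟨b, hb, hL⟩ := forces_C9 hq hJ (hne 0 1 (by decide)) (hne 0 2 (by decide))
    (hne 0 3 (by decide)) (hne 1 2 (by decide)) (hne 1 3 (by decide)) (hne 2 3 (by decide))
    (hT 0).ge (hT 1).ge (hT 2).ge (hT 3).ge
  rw [← range_vec₁] at hL
  have hv : Function.Injective ![b] := Function.injective_of_subsingleton _
  rcases hL with hL | hL
  · exact ⟨_, .inl rfl, _, hL.isSubdivisionAt_sumElim hui hv (by simpa using hb) (by simp),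
      fun i => rfl⟩
  · exact ⟨_, .inr rfl, _, hL.isSubdivisionAt_sumElim hui hv (by simpa using hb) (by simp),
      fun i => rfl⟩

theorem unavoidable_C7 : Config.Unavoidable.{u} C7 := by
  intro V _ G q hq u hu
  have hui := hu.1
  obtain ⟨T, hJ, hT⟩ := hu.joined hq
  have hne : ∀ i j, i ≠ j → u i ≠ u j := fun i j => hui.ne
  obtain ⟨b, c, hb, hc, hbc, hL⟩ := forces_C7 hq hJ (hne 0 1 (by decide)) (hne 0 2 (by decide))
    (hne 1 2 (by decide)) (hT 0).ge (hT 1).ge (hT 2).ge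
  rw [← range_vec₂] at hL
  exact ⟨_, rfl, _, hL.isSubdivisionAt_sumElim hui (injective_vec₂ hbc)
    (Fin.forall_fin_two.2 ⟨hb, hc⟩) (by simp), fun i => rfl⟩

theorem unavoidable_C8 : Config.Unavoidable.{u} C8 := by
  intro V _ G q hq u hu
  have hui := hu.1
  obtain ⟨T, hJ, hT⟩ := hu.joined hq
  have hne : ∀ i j, i ≠ j → u i ≠ u j := fun i j => hui.ne
  obtain ⟨b, c, hb, hc, hbc, hL⟩ := forces_C8 hq hJ (hne 0 1 (by decide)) (hne 0 2 (by decide))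
    (hne 1 2 (by decide)) (hT 0).ge (hT 1).ge (hT 2).ge
  rw [← range_vec₂] at hL
  exact ⟨_, rfl, _, hL.isSubdivisionAt_sumElim hui (injective_vec₂ hbc)
    (Fin.forall_fin_two.2 ⟨hb, hc⟩) (by simp), fun i => rfl⟩

theorem unavoidable_C6 : Config.Unavoidable.{u} C6 := by
  intro V _ G q hq u hu
  have hui := hu.1
  obtain ⟨T, hJ, hT⟩ := hu.joined hq
  have hne : ∀ i j, i ≠ j → u i ≠ u j := fun i j => hui.ne
  obtain ⟨b, c, d, hZ, ⟨hbc, hbd, hcd⟩, hL⟩ := forces_C6 hq hJ (hne 0 1 (by decide))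
    (hne 0 2 (by decide)) (hne 1 2 (by decide)) (hT 0).ge (hT 1).ge (hT 2).ge
  rw [← range_vec₃] at hL
  have hv := injective_vec₃ hbc hbd hcd
  have hd : ∀ j, ![b, c, d] j ∉ Set.range u := by simpa [Fin.forall_fin_succ] using hZ
  rcases hL with hL | hL | hL
  · exact ⟨_, .inl rfl, _, hL.isSubdivisionAt_sumElim hui hv hd (by simp [triadEdges]),
      fun i => rfl⟩
  · exact ⟨_, .inr (.inl rfl), _, hL.isSubdivisionAt_sumElim hui hv hd (by simp [triadEdges]),
      fun i => rfl⟩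
  · exact ⟨_, .inr (.inr rfl), _, hL.isSubdivisionAt_sumElim hui hv hd (by simp [triadEdges]),
      fun i => rfl⟩

theorem unavoidable_C5 : Config.Unavoidable.{u} C5 := by
  intro V _ G q hq u hu
  have hui := hu.1
  obtain ⟨T, hJ, hT⟩ := hu.joined hq
  obtain ⟨z, b, c, d, hZ, ⟨hzb, hzc, hzd, hbc, hbd, hcd⟩, hL⟩ := forces_C5 hq hJ
    (hui.ne (by decide : (0 : Fin 2) ≠ 1)) (hT 0).ge (hT 1).ge
  rw [← range_vec₄] at hL
  have hv := injective_vec₄ hzb hzc hbc hzd hbd hcd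
  have hd : ∀ j, ![z, b, c, d] j ∉ Set.range u := by simpa [Fin.forall_fin_succ] using hZ
  rcases hL with hL | hL | hL
  · exact ⟨_, .inl rfl, _, hL.isSubdivisionAt_sumElim hui hv hd (by simp [triadEdges]),
      fun i => rfl⟩
  · exact ⟨_, .inr (.inl rfl), _, hL.isSubdivisionAt_sumElim hui hv hd (by simp [triadEdges]),
      fun i => rfl⟩
  · exact ⟨_, .inr (.inr rfl), _, hL.isSubdivisionAt_sumElim hui hv hd (by simp [triadEdges]),
      fun i => rfl⟩

/-! ### Graphs of minimum degree at least 5 -/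

/-- A graph of `C6` together with a triangle on the terminals is the cube of the path
`z, y, x, b, c, d`. -/
theorem Linkage.containsSubdivision_pathCube {x y z b c d : V}
    (hL : Linkage G Z ({s(x, y), s(x, z), s(y, z)} ∪ triadEdges x y z b c d))
    (hZ : ∀ v ∈ [z, y, x, b, c, d], v ∈ Z) (hn : [z, y, x, b, c, d].Nodup) :
    ContainsSubdivision G (pathCube 6) := by
  refine ⟨[z, y, x, b, c, d].get, hL.isSubdivisionAt (List.nodup_iff_injective_get.1 hn)
    (fun i => hZ _ (List.get_mem _ _)) fun i j hij => ?_⟩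
  fin_cases i <;> fin_cases j <;> simp [pathCube, triadEdges] at hij ⊢

/-- Five links from one terminal force a subdivision of `pathCube 6`. The links of `u` can be
rerouted until they lead to the whole clique, whose first vertex `w` is adjacent to the others.
When `w` is taken out of the clique, `u` and `w` are the terminals of the configuration `C5`,
with a further path between them. -/
theorem contains_pathCube_of_joined (hq : Derives (.start G) q) (hJ : Joined G q Z T) {u : V}
    (hu : 5 ≤ (T u).card) : ContainsSubdivision G (pathCube 6) := by
  classical
  induction hq generalizing Z T with
  | refl =>
    obtain ⟨k, hk⟩ := Finset.card_pos.1 (by omega : 0 < (T u).card)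
    exact absurd (hJ.2.1 _ k hk).2 List.not_mem_nil
  | @tail q₀ q hq₀ hs ih =>
    rcases hs with ⟨w, hw⟩ | ⟨v, hv⟩
    swap
    · obtain ⟨T₀, hT₀, hc⟩ := hJ.of_deletes hv
      exact ih hT₀ (by rwa [hc])
    by_cases hwu : w ∈ T u
    swap
    · exact ih (hJ.erase hw) (by rwa [Finset.erase_eq_of_notMem hwu])
    by_cases hk : ∃ k ∈ q₀.clique, k ∉ T u
    · obtain ⟨k, hk, hku⟩ := hk
      refine ih (hJ.reroute hq₀ hw hwu hk hku) ?_
      rw [if_pos rfl, Finset.card_insert_of_notMem (by simp [hku]), Finset.card_erase_of_mem hwu]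
      omega
    have huZ := (hJ.2.1 u w hwu).1
    have herase := (hJ.erase hw).2.1
    obtain ⟨hwZ, Y, hJ', hY, hlift⟩ := hJ.branch hq₀ hw
    have hwne : u ≠ w := by
      rintro rfl
      exact hwZ huZ
    have hcard : 4 ≤ ((T u).erase w).card := by
      rw [Finset.card_erase_of_mem hwu]
      omega
    obtain ⟨a, b, c, d, ⟨ha, hb, hc, hd⟩, ⟨hab, hac, had, hbc, hbd, hcd⟩, hL⟩ :=
      forces_C5 hq₀ hJ' hwne (by rwa [if_neg hwne]) (by
        rw [if_pos rfl]
        exact hcard.trans (Finset.card_le_card fun k hk => by simpa using (herase u k hk).2))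
    have hmem : ∀ v ∈ [u, w, a, b, c, d], v ∈ ({a, b, c, d} ∪ (insert w Z ∪ Y)) \ Y := by
      have huY : u ∉ Y := Set.disjoint_left.1 hY (.inr huZ)
      have hwY : w ∉ Y := Set.disjoint_left.1 hY (.inl rfl)
      simp only [Set.mem_union, not_or] at ha hb hc hd
      simp [*]
    have hnodup : [u, w, a, b, c, d].Nodup := by
      have hx : ∀ x, x ∉ insert w Z ∪ Y → u ≠ x ∧ w ≠ x := by
        intro x hx
        constructor <;> rintro rfl <;> simp [huZ] at hx
      simp [hx a ha, hx b hb, hx c hc, hx d hd, *]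
    have key : ∀ {E}, Linkage G ({a, b, c, d} ∪ (insert w Z ∪ Y)) E →
        Linkage G (({a, b, c, d} ∪ (insert w Z ∪ Y)) \ Y) (E ∪ {s(w, u)}) := fun hL =>
      (hlift _ _ (fun y hy => .inr (.inr hy)) hL).mono subset_rfl
        (Set.union_subset_union_right _ (by simpa using ⟨u, hwu, .inl rfl⟩))
    rcases hL with hL | hL | hL
    · exact ((key hL).mono subset_rfl (by simp [triadEdges, Set.insert_subset_iff])
        : Linkage G _ ({s(u, w), s(u, a), s(w, a)} ∪ triadEdges u w a b c d)
        ).containsSubdivision_pathCube (fun v hv => hmem v (by simp at hv ⊢; tauto))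
        (by simp at hnodup ⊢; grind)
    · exact ((key hL).mono subset_rfl (by simp [triadEdges, Set.insert_subset_iff])
        : Linkage G _ ({s(a, u), s(a, w), s(u, w)} ∪ triadEdges a u w b c d)
        ).containsSubdivision_pathCube (fun v hv => hmem v (by simp at hv ⊢; tauto))
        (by simp at hnodup ⊢; grind)
    · exact ((key hL).mono subset_rfl (by simp [triadEdges, Set.insert_subset_iff])
        : Linkage G _ ({s(w, a), s(w, u), s(a, u)} ∪ triadEdges w a u b c d)
        ).containsSubdivision_pathCube (fun v hv => hmem v (by simp at hv ⊢; tauto))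
        (by simp at hnodup ⊢; grind)

theorem exists_isFirstNonNeighbor {L : List V} {x : V} (h : ∃ y ∈ L, ¬ G.Adj x y) :
    ∃ y ∈ L, IsFirstNonNeighbor G L x y := by
  induction L with
  | nil => simp at h
  | cons k L ih =>
    by_cases hk : G.Adj x k
    · obtain ⟨y, hy, A, B, rfl, hA, hxy⟩ := ih (by simpa [hk] using h)
      exact ⟨y, by simp, k :: A, B, by simp, by simpa [hk] using hA, hxy⟩
    · exact ⟨k, by simp, [], L, by simp, by simp, hk⟩

namespace CliquePair

/-- The vertices of the graph outside the clique. -/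
def outer (p : CliquePair V) : Set V := {x | x ∈ p.verts ∧ x ∉ p.clique}

theorem exists_addsVertex (p : CliquePair V) {w : V} (hw : w ∈ p.outer)
    (hadj : ∀ x ∈ p.clique, p.graph.Adj w x) : ∃ p', AddsVertex p p' w := by
  refine ⟨⟨p.verts, p.graph, p.mem_verts, w :: p.clique, List.nodup_cons.2 ⟨hw.2, p.nodup⟩, ?_, ?_⟩,
    hw.1, hw.2, hadj, rfl, rfl, rfl⟩
  · simpa using ⟨hw.1, p.clique_verts⟩
  · intro x hx y hy hxy
    rcases List.mem_cons.1 hx with rfl | hx' <;> rcases List.mem_cons.1 hy with rfl | hy'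
    exacts [absurd rfl hxy, hadj y hy', (hadj x hx').symm, p.clique_adj x hx' y hy' hxy]

theorem exists_deletesVertex (p : CliquePair V) (hout : p.outer.Nonempty)
    (hadj : ∀ x ∈ p.outer, ∃ y ∈ p.clique, ¬ p.graph.Adj x y) :
    ∃ p' v, v ∈ p.clique ∧ DeletesVertex p p' v := by
  obtain ⟨verts, graph, mem_verts, _ | ⟨v, L⟩, nodup, clique_verts, clique_adj⟩ := p
  · obtain ⟨x, hx⟩ := hout
    obtain ⟨y, hy, -⟩ := hadj x hx
    exact absurd hy List.not_mem_nil
  have hfirst : ∀ {x y}, IsFirstNonNeighbor graph (v :: L) x y → y ∈ v :: L := by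
    rintro x y ⟨A, B, h, -⟩
    simp [h]
  have hvL : v ∉ L := (List.nodup_cons.1 nodup).1
  have hLv : ∀ x ∈ L, x ≠ v := by
    rintro x hx rfl
    exact hvL hx
  let graph' : SimpleGraph V :=
    { Adj := fun x y => x ≠ v ∧ y ≠ v ∧
        (graph.Adj x y ∨
          (graph.Adj v x ∧ x ∉ v :: L ∧ IsFirstNonNeighbor graph (v :: L) x y) ∨
          (graph.Adj v y ∧ y ∉ v :: L ∧ IsFirstNonNeighbor graph (v :: L) y x))
      symm := ⟨fun x y ⟨hx, hy, h⟩ => ⟨hy, hx, h.imp (fun h => h.symm) Or.symm⟩⟩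
      loopless := ⟨fun x ⟨hx, _, h⟩ => by
        rcases h with h | h | h
        exacts [graph.loopless.irrefl x h, h.2.1 (hfirst h.2.2), h.2.1 (hfirst h.2.2)]⟩ }
  refine ⟨⟨verts \ {v}, graph', ?_, L, (List.nodup_cons.1 nodup).2, ?_, ?_⟩, v, List.mem_cons_self,
    hout, fun x hx hxc => hadj x ⟨hx, hxc⟩, rfl, rfl, fun x y => Iff.rfl⟩
  · rintro x y ⟨hx, hy, h | h | h⟩
    · exact ⟨mem_verts _ _ h, hx⟩
    · exact ⟨mem_verts _ _ h.1.symm, hx⟩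
    · exact ⟨clique_verts _ (hfirst h.2.2), hx⟩
  · exact fun x hx => ⟨clique_verts x (List.mem_cons_of_mem _ hx), hLv x hx⟩
  · exact fun x hx y hy hxy => ⟨hLv x hx, hLv y hy,
      .inl (clique_adj x (List.mem_cons_of_mem _ hx) y (List.mem_cons_of_mem _ hy) hxy)⟩

end CliquePair

theorem DeletesVertex.outer_eq {p p' : CliquePair V} {v : V} (h : DeletesVertex p p' v) :
    p'.outer = p.outer := by
  obtain ⟨-, -, hc, hv, -⟩ := h
  have := p.nodup
  rw [hc, List.nodup_cons] at this
  ext x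
  simp only [CliquePair.outer, hv, hc, Set.mem_ofPred_eq, Set.mem_sdiff, Set.mem_singleton_iff,
    List.mem_cons, not_or]
  tauto

/-- Deleting a vertex of the clique does not decrease the degrees of the vertices outside it. -/
theorem DeletesVertex.ncard_neighborSet_le [Finite V] {p p' : CliquePair V} {v x : V}
    (h : DeletesVertex p p' v) (hx : x ∈ p.outer) :
    (p.graph.neighborSet x).ncard ≤ (p'.graph.neighborSet x).ncard := by
  obtain ⟨-, hnon, hc, hv, hg⟩ := h
  have hxv : x ≠ v := by
    rintro rfl
    exact hx.2 (by simp [hc])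
  have hsub : p.graph.neighborSet x \ {v} ⊆ p'.graph.neighborSet x :=
    fun y hy => (hg x y).2 ⟨hxv, hy.2, .inl hy.1⟩
  by_cases hvx : p.graph.Adj v x
  · obtain ⟨y, hy, hfirst⟩ := exists_isFirstNonNeighbor (hnon x hx.1 hx.2)
    have hxy : ¬ p.graph.Adj x y := by
      obtain ⟨A, B, -, -, h⟩ := hfirst
      exact h
    have hyv : y ≠ v := by
      rintro rfl
      exact hxy hvx.symm
    have hins : insert y (p.graph.neighborSet x \ {v}) ⊆ p'.graph.neighborSet x :=
      Set.insert_subset ((hg x y).2 ⟨hxv, hyv, .inr (.inl ⟨hvx, hx.2, hfirst⟩)⟩) hsub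
    refine le_trans ?_ (Set.ncard_le_ncard hins)
    rw [Set.ncard_insert_of_notMem (fun h => hxy h.1),
      Set.ncard_sdiff_singleton_add_one (by exact hvx.symm)]
  · refine Set.ncard_le_ncard fun y hy => hsub ⟨hy, ?_⟩
    rintro rfl
    exact hvx (SimpleGraph.Adj.symm hy)

/-- The operations can be applied until only one vertex lies outside the clique. -/
theorem exists_derives_outer_singleton [Finite V] {d : ℕ} (hq : Derives (.start G) q)
    (hout : q.outer.Nonempty) (hd : ∀ x ∈ q.outer, d ≤ (q.graph.neighborSet x).ncard) :
    ∃ q', Derives (.start G) q' ∧ ∃ u, q'.outer = {u} ∧ d ≤ (q'.graph.neighborSet u).ncard := by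
  -- an addition decreases the second summand, a deletion the first one
  induction hn : q.verts.ncard + q.outer.ncard using Nat.strong_induction_on generalizing q with
  | _ n ih =>
    subst hn
    by_cases hadj : ∃ w ∈ q.outer, ∀ x ∈ q.clique, q.graph.Adj w x
    · obtain ⟨w, hw, hadj⟩ := hadj
      by_cases hne : (q.outer \ {w}).Nonempty
      · obtain ⟨q', hq'⟩ := q.exists_addsVertex hw hadj
        have ho : q'.outer = q.outer \ {w} := by
          obtain ⟨-, -, -, hv, -, hc⟩ := hq'
          ext x
          simp only [CliquePair.outer, hv, hc, Set.mem_ofPred_eq, Set.mem_sdiff,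
            Set.mem_singleton_iff, List.mem_cons, not_or]
          tauto
        refine ih _ ?_ (hq.tail (.inl ⟨w, hq'⟩)) (ho ▸ hne) (fun x hx => ?_) rfl
        · rw [hq'.2.2.2.1, ho]
          exact Nat.add_lt_add_left (Set.ncard_sdiff_singleton_lt_of_mem hw) _
        · rw [hq'.2.2.2.2.1]
          rw [ho] at hx
          exact hd x hx.1
      · have : q.outer = {w} := by
          rw [Set.not_nonempty_iff_eq_empty, Set.sdiff_eq_empty] at hne
          exact hne.antisymm (by simpa using hw)
        exact ⟨q, hq, w, this, hd w hw⟩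
    · push Not at hadj
      obtain ⟨q', v, hvc, hq'⟩ := q.exists_deletesVertex hout hadj
      refine ih _ ?_ (hq.tail (.inr ⟨v, hq'⟩)) (hq'.outer_eq ▸ hout) (fun x hx => ?_) rfl
      · rw [hq'.outer_eq, hq'.2.2.2.1]
        exact Nat.add_lt_add_right (Set.ncard_sdiff_singleton_lt_of_mem (q.clique_verts v hvc)) _
      · rw [hq'.outer_eq] at hx
        exact (hd x hx).trans (hq'.ncard_neighborSet_le hx)

theorem contains_pathCube_of_minDegree [Fintype V] [DecidableRel G.Adj] (h : 5 ≤ G.minDegree) :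
    ContainsSubdivision G (pathCube 6) := by
  classical
  have hne : Nonempty V := by
    by_contra hV
    rw [not_nonempty_iff] at hV
    simp at h
  have hout : (CliquePair.start G).outer = Set.univ := by
    ext
    simp [CliquePair.outer, CliquePair.start]
  obtain ⟨q, hq, u, hu, hd⟩ := exists_derives_outer_singleton (d := 5) (q := .start G) .refl
    (by simp [hout]) fun x _ => by
      have := h.trans (G.minDegree_le_degree x)
      rwa [← G.card_neighborFinset_eq_degree, ← Set.ncard_coe_finset, G.coe_neighborFinset] at this
  have huo : u ∈ q.verts ∧ u ∉ q.clique := by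
    have : u ∈ q.outer := by simp [hu]
    exact this
  refine contains_pathCube_of_joined (Z := {u}) (u := u)
    (T := fun v => if v = u then (q.graph.neighborSet u).toFinset else ∅) hq
    ⟨by simpa using huo, fun v k hk => ?_, fun _ _ => ∅,
      fun v k hk => ⟨by simp, v, .refl (by simp), ?_⟩,
      by simp⟩ ?_
  · beta_reduce at hk
    split_ifs at hk with hv
    swap
    · simp at hk
    have hadj : q.graph.Adj u k := by simpa using hk
    refine ⟨hv, ?_⟩
    by_contra hkc
    have : k ∈ q.outer := ⟨q.mem_verts _ _ hadj.symm, hkc⟩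
    rw [hu] at this
    exact hadj.ne this.symm
  · beta_reduce at hk
    split_ifs at hk with hv
    · subst hv
      simpa using hk
    · simp at hk
  · rw [if_pos rfl, ← Set.ncard_eq_toFinset_card']
    exact hd

end UnavoidableConfig

theorem theoremP6 :
    (∀ (V : Type u) [Fintype V] (G : SimpleGraph V) [DecidableRel G.Adj],
      5 ≤ G.minDegree →
        UnavoidableConfig.ContainsSubdivision G (UnavoidableConfig.pathCube 6)) ∧
    UnavoidableConfig.Config.Unavoidable.{u} UnavoidableConfig.C5 ∧
    UnavoidableConfig.Config.Unavoidable.{u} UnavoidableConfig.C6 ∧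
    UnavoidableConfig.Config.Unavoidable.{u} UnavoidableConfig.C7 ∧
    UnavoidableConfig.Config.Unavoidable.{u} UnavoidableConfig.C8 ∧
    UnavoidableConfig.Config.Unavoidable.{u} UnavoidableConfig.C9 :=
  ⟨fun _ _ _ _ h => UnavoidableConfig.contains_pathCube_of_minDegree h,
    UnavoidableConfig.unavoidable_C5, UnavoidableConfig.unavoidable_C6,
    UnavoidableConfig.unavoidable_C7, UnavoidableConfig.unavoidable_C8,
    UnavoidableConfig.unavoidable_C9⟩
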